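/- **Conventions.** For a group $G$, a quasimorphism is a function $\varphi:G\to\mathbb R$ with $\sup_{g,h\in G}|\varphi(g)+\varphi(h)-\varphi(gh)|<\infty$; it is antisymmetric if $\varphi(g^{-1})=-\varphi(g)$ for all $g\in G$. A quasimorphism $\varphi$ on a subgroup $K<G$ is $G$-quasi-invariant if $\sup\{|\varphi(k_1)-\varphi(k_2)| : k_1,k_2\in K \text{ conjugate in } G\}<\infty$. For $K<G$ and $X\subset G$ with $G=\langle K\cup X\rangle$ (a relative generating set), let $F(X)$ be the free group on $X$, let $\theta:K*F(X)\to G$ be the natural projection, let $\eta:K*F(X)\to K$ be the homomorphism that is the identity on $K$ and trivial on $X$, and let $|a|$ be the word length of $a\in K*F(X)$ with respect to the letters in $K\sqcup X^{\pm1}$. A quasimorphism $\varphi$ on $K$ is $(G,X)$-controlled if there is a function $f:\mathbb N\to\mathbb R$ such that $|\varphi(\eta(a))|\le f(n)$ for all $n$ and all $a\in\ker\theta$ with $|a|\le n$. $G$ is hyperbolic relative to $K$ if there are a relative generating set $X$, a finite set $R\subset K*F(X)$ whose normal closure is $\ker\theta$, and a constant $C$ such that for every $n$, each $a\in\ker\theta$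 with $|a|\le n$ is a product of at most $Cn+C$ conjugates of elements of $R^{\pm1}$. A group is hyperbolic if it is generated by a finite set whose Cayley graph is Gromov hyperbolic. A transversal of a normal subgroup $N$ of $H$ is a set of coset representatives, one for each coset of $N$ in $H$. **Statement.** Let $G$ be a group, $K$ a normal subgroup of $G$, and $\varphi:K\to\mathbb R$ an antisymmetric $G$-quasi-invariant quasimorphism. 1. Let $H<G$ be a subgroup such that $G/K$ is hyperbolic relative to $H/(K\cap H)$ (identified with the image of $H$ in $G/K$). If there exists a transversal $L$ of $K\cap H$ in $H$ such that the restriction $\varphi|_{K\cap H}$ is $(H,L)$-controlled, then $\varphi$ extends to an antisymmetric quasimorphism on $G$. 2. If $G/K$ is hyperbolic, then $\varphi$ extends to an antisymmetric quasimorphism on $G$. -/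

import Mathlib

/-- A real-valued function on a group with finite defect. -/
def IsQuasimorphism {G : Type*} [Group G] (φ : G → ℝ) : Prop :=
  ∃ D : ℝ, ∀ g h : G, |φ g + φ h - φ (g * h)| ≤ D

/-- `φ (g⁻¹) = -φ g` for all `g`. -/
def IsAntisymmetricFun {G : Type*} [Group G] (φ : G → ℝ) : Prop :=
  ∀ g : G, φ g⁻¹ = -φ g

/-- A function on a subgroup `K` of `G` is `G`-quasi-invariant if its values at any two elements
of `K` that are conjugate in `G` differ by a uniformly bounded amount. -/
def IsQuasiInvariant {G : Type*} [Group G] (K : Subgroup G) (φ : K → ℝ) : Prop :=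
  ∃ D : ℝ, ∀ k₁ k₂ : K, IsConj (k₁ : G) (k₂ : G) → |φ k₁ - φ k₂| ≤ D

/-- The free product `K * F(X)`. -/
abbrev RelFree {G : Type*} [Group G] (K : Subgroup G) (X : Set G) : Type _ :=
  Monoid.Coprod K (FreeGroup X)

/-- The natural map `θ : K * F(X) → G`, the inclusion on `K` and on `X`. -/
def relTheta {G : Type*} [Group G] (K : Subgroup G) (X : Set G) : RelFree K X →* G :=
  Monoid.Coprod.lift K.subtype (FreeGroup.lift (fun x : X => (x : G)))

/-- The natural map `η : K * F(X) → K`, the identity on `K` and trivial on `X`. -/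
def relEta {G : Type*} [Group G] (K : Subgroup G) (X : Set G) : RelFree K X →* K :=
  Monoid.Coprod.fst

/-- The letters: an element of `K`, an element `x` of `X`, or the formal inverse of `x ∈ X`. -/
def relLetter {G : Type*} [Group G] (K : Subgroup G) (X : Set G) :
    K ⊕ (X × Bool) → RelFree K X
  | Sum.inl k => Monoid.Coprod.inl k
  | Sum.inr (x, true) => Monoid.Coprod.inr (FreeGroup.of x)
  | Sum.inr (x, false) => Monoid.Coprod.inr (FreeGroup.of x)⁻¹

/-- The element of `K * F(X)` represented by a word. -/
def relWordProd {G : Type*} [Group G] (K : Subgroup G) (X : Set G)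
    (w : List (K ⊕ (X × Bool))) : RelFree K X :=
  (w.map (relLetter K X)).prod

theorem relWordProd_append {G : Type*} [Group G] (K : Subgroup G) (X : Set G)
    (v w : List (K ⊕ (X × Bool))) :
    relWordProd K X (v ++ w) = relWordProd K X v * relWordProd K X w := by
  simp [relWordProd]

/-- Every element of `K * F(X)` is represented by a word, so the word length below is the minimum
of a non-empty set. -/
theorem relWordProd_surjective {G : Type*} [Group G] (K : Subgroup G) (X : Set G)
    (a : RelFree K X) : ∃ w : List (K ⊕ (X × Bool)), relWordProd K X w = a := by
  induction a using Monoid.Coprod.induction_on with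
  | inl k => exact ⟨[Sum.inl k], by simp [relWordProd, relLetter]⟩
  | inr u =>
    induction u using FreeGroup.induction_on with
    | C1 => exact ⟨[], by simp [relWordProd]⟩
    | of x => exact ⟨[Sum.inr (x, true)], by simp [relWordProd, relLetter]⟩
    | inv_of x _ => exact ⟨[Sum.inr (x, false)], by simp [relWordProd, relLetter]⟩
    | mul u v hu hv =>
      obtain ⟨p, hp⟩ := hu
      obtain ⟨q, hq⟩ := hv
      exact ⟨p ++ q, by rw [relWordProd_append, hp, hq, map_mul]⟩
  | mul a b ha hb =>
    obtain ⟨p, hp⟩ := ha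
    obtain ⟨q, hq⟩ := hb
    exact ⟨p ++ q, by rw [relWordProd_append, hp, hq]⟩

/-- The word length of `a ∈ K * F(X)` with respect to the letters from `K` and `X` (and their
inverses). -/
noncomputable def relLength {G : Type*} [Group G] (K : Subgroup G) (X : Set G)
    (a : RelFree K X) : ℕ :=
  sInf {n | ∃ w : List (K ⊕ (X × Bool)), w.length = n ∧ relWordProd K X w = a}

/-- `X` is a relative generating set of `G` with respect to `K`. -/
def IsRelGeneratingSet {G : Type*} [Group G] (K : Subgroup G) (X : Set G) : Prop :=
  Subgroup.closure ((K : Set G) ∪ X) = ⊤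

/-- `φ` is `(G, X)`-controlled by `f`: every `a ∈ ker θ` of length at most `n` satisfies
`|φ (η a)| ≤ f n`. -/
def IsControlledBy {G : Type*} [Group G] (K : Subgroup G) (X : Set G) (φ : K → ℝ)
    (f : ℕ → ℝ) : Prop :=
  ∀ (n : ℕ) (a : RelFree K X), a ∈ (relTheta K X).ker → relLength K X a ≤ n →
    |φ (relEta K X a)| ≤ f n

/-- `φ` is `(G, X)`-controlled. -/
def IsControlled {G : Type*} [Group G] (K : Subgroup G) (X : Set G) (φ : K → ℝ) : Prop :=
  ∃ f : ℕ → ℝ, IsControlledBy K X φ f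

/-- `⟨K, X ∣ R_K, R⟩` is a relative presentation of `G`, where the relators in `R` are regarded as
elements of `K * F(X)` (the relations `R_K` of `K` hold there already). -/
def IsRelPresentation {G : Type*} [Group G] (K : Subgroup G) (X : Set G)
    (R : Set (RelFree K X)) : Prop :=
  IsRelGeneratingSet K X ∧ Subgroup.normalClosure R = (relTheta K X).ker

/-- `f` is a relative isoperimetric function of `⟨K, X ∣ R_K, R⟩`: every `a ∈ ker θ` of length at
most `n` is a product of at most `f n` conjugates of elements of `R` and their inverses. -/
def IsRelIsoperimetric {G : Type*} [Group G] (K : Subgroup G) (X : Set G)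
    (R : Set (RelFree K X)) (f : ℕ → ℝ) : Prop :=
  ∀ (n : ℕ) (a : RelFree K X), a ∈ (relTheta K X).ker → relLength K X a ≤ n →
    ∃ l : List (RelFree K X × RelFree K X), (l.length : ℝ) ≤ f n ∧
      (∀ p ∈ l, p.2 ∈ R ∨ p.2⁻¹ ∈ R) ∧ a = (l.map (fun p => p.1 * p.2 * p.1⁻¹)).prod

/-- `G` is hyperbolic relative to `K`: for some relative generating set `X` there is a finite
relative presentation with a linear relative isoperimetric function. -/
def IsRelHyperbolic {G : Type*} [Group G] (K : Subgroup G) : Prop :=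
  ∃ (X : Set G) (R : Set (RelFree K X)), R.Finite ∧ IsRelPresentation K X R ∧
    ∃ C : ℝ, IsRelIsoperimetric K X R (fun n => C * n + C)

/-- A group is (Gromov) hyperbolic if it has a finite generating set `S` such that the graph metric
of the Cayley graph of `S` satisfies Gromov's four-point condition for some `δ`. -/
def IsHyperbolicGroup (G : Type*) [Group G] : Prop :=
  ∃ S : Set G, S.Finite ∧ Subgroup.closure S = ⊤ ∧ ∃ δ : ℕ, ∀ x y z w : G,
    (SimpleGraph.mulCayley S).dist x y + (SimpleGraph.mulCayley S).dist z w ≤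
      max ((SimpleGraph.mulCayley S).dist x z + (SimpleGraph.mulCayley S).dist y w)
        ((SimpleGraph.mulCayley S).dist x w + (SimpleGraph.mulCayley S).dist y z) + δ

/-- The restriction of a function on `K` to `K ∩ H`, where `K ∩ H` is regarded as a subgroup
of `H`. -/
def restrictInter {G : Type*} [Group G] (K H : Subgroup G) (φ : K → ℝ) :
    K.subgroupOf H → ℝ :=
  fun x => φ ⟨((x : H) : G), Subgroup.mem_subgroupOf.mp x.2⟩

/-- `φ` extends from `K` to an antisymmetric quasimorphism on `G`. -/
def ExtendsAntisymmetrically {G : Type*} [Group G] (K : Subgroup G) (φ : K → ℝ) : Prop :=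
  ∃ Φ : G → ℝ, IsQuasimorphism Φ ∧ IsAntisymmetricFun Φ ∧ ∀ k : K, Φ (k : G) = φ k

/-! Put Γ = G/K with projection π, and choose letters in G whose images generate Γ. Suppose |φ(w)| ≤
C(|w| + 1) for every word w in them representing an element of K. Let P(g) be the infimum of φ(w⁻¹g)
+ (C + 1)|w| over words w with the same image as g (`wordMin`). It is finite, coarsely subadditive,
and at bounded distance from φ on K. The extension, up to bounded error, is Φ(g) = (P(g) -
P(g⁻¹))/2. It is a quasimorphism once every triple x, y, z has a coarse centre p: a point through
which each of the six values P(x⁻¹y), P(y⁻¹x), ... splits up to a bounded error. Around the triangle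
the contributions of p to Φ then cancel (`IsLinearOnKernel.exists_extension`).

Centres come from hyperbolicity of Γ, used in the form `HasLinearIntegrals`: integrals of f dg
around loops grow at most linearly. The sum P(g) + P(g⁻¹) induces a pseudo-distance on Γ, and
near-minimizing words trace paths that are tame for it. On such a side take g to be the
pseudo-distance from its start and f the graph distance to the other sides. If the side has length n
and stays at distance A from the others, the integral is about A·n, while f vanishes on the other
sides; for large A this contradicts linearity unless n is bounded (`IsTame.hexagon_le`). Hence
triangles are thin (`HasLinearIntegrals.exists_thin`) and have centres
(`IsCoarseWeight.exists_center`).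

The linear bound on words is itself obtained from the same criterion, applied upstairs. Let Γ be
hyperbolic relative to Q, and let E be the fibre product of G and Q * F(X) over Γ. The kernel of E →
Q * F(X) is a copy of K, and normal forms in the free product give the linear bound there, because Q
has a lift to G of bounded defect. The criterion yields a quasimorphism Ψ on E, bounded on letters
and on conjugates of the finitely many elements (1, r), r a relator. The linear relative
isoperimetric inequality writes a word trivial in Γ as a product of linearly many conjugates of
relators, so Ψ supplies the linear bound over Γ. A second application of the criterion gives Φ.

A controlled transversal supplies the lift of bounded defect. For hyperbolic Γ one takes Q trivial;
Dehn's algorithm gives the isoperimetric inequality. -/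

/-! ### Discrete line integrals and tame paths. -/

section PathIntegrals

variable {V : Type*}

/-- `IsPath adj u v n`: there is an `adj`-path of length `n` from `u` to `v`. -/
inductive IsPath (adj : V → V → Prop) : V → V → ℕ → Prop
  | nil (u : V) : IsPath adj u u 0
  | cons {u v z : V} {n : ℕ} : adj u v → IsPath adj v z n → IsPath adj u z (n + 1)

/-- `PathIntegral adj f g u v n J`: along some `adj`-path of length `n` from `u` to `v`, the discrete
line integral of `f dg` equals `J`. -/
inductive PathIntegral (adj : V → V → Prop) (f g : V → ℝ) : V → V → ℕ → ℝ → Prop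
  | nil (u : V) : PathIntegral adj f g u u 0 0
  | cons {u v z : V} {n : ℕ} {J : ℝ} : adj u v → PathIntegral adj f g v z n J →
      PathIntegral adj f g u z (n + 1) (f u * (g v - g u) + J)

variable {adj : V → V → Prop} {f g : V → ℝ}

theorem PathIntegral.trans {u v z : V} {m n : ℕ} {I J : ℝ} (h : PathIntegral adj f g u v m I)
    (h' : PathIntegral adj f g v z n J) : PathIntegral adj f g u z (m + n) (I + J) := by
  induction h with
  | nil => simpa using h'
  | @cons u w v m I huw _ ih =>
    have := (ih h').cons huw
    rwa [← add_assoc, add_right_comm m n 1] at this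

theorem PathIntegral.single {u v : V} (h : adj u v) :
    PathIntegral adj f g u v 1 (f u * (g v - g u)) := by
  simpa using (PathIntegral.nil (adj := adj) (f := f) (g := g) v).cons h

theorem IsPath.trans {u v z : V} {m n : ℕ} (h : IsPath adj u v m) (h' : IsPath adj v z n) :
    IsPath adj u z (m + n) := by
  induction h with
  | nil => simpa using h'
  | @cons u w v m huw _ ih =>
    have := (ih h').cons huw
    rwa [add_right_comm m n 1] at this

theorem IsPath.single {u v : V} (h : adj u v) : IsPath adj u v 1 := (IsPath.nil v).cons h

theorem IsPath.symm (hs : ∀ u v, adj u v → adj v u) {u v : V} {n : ℕ} (h : IsPath adj u v n) :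
    IsPath adj v u n := by
  induction h with
  | nil => exact .nil _
  | cons huw _ ih => exact ih.trans (.single (hs _ _ huw))

theorem IsPath.lipschitz {u v : V} {n : ℕ} (h : IsPath adj u v n) {M : ℝ}
    (hg : ∀ u v, adj u v → |g u - g v| ≤ M) : |g u - g v| ≤ n * M := by
  induction h with
  | nil => simp
  | @cons u w v n huw _ ih =>
    have := abs_sub_le (g u) (g w) (g v)
    push_cast
    linarith [hg u w huw]

theorem IsPath.exists_pathIntegral {u v : V} {n : ℕ} (h : IsPath adj u v n) {M F : ℝ}
    (hf : ∀ u v, adj u v → |f u - f v| ≤ 1) (hg : ∀ u v, adj u v → |g u - g v| ≤ M)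
    (hu : |f u| + n ≤ F) : ∃ J, PathIntegral adj f g u v n J ∧ |J| ≤ n * (F * M) := by
  induction h with
  | nil => exact ⟨0, .nil _, by simp⟩
  | @cons u w v n huw _ ih =>
    push_cast at hu
    have h1 : |f w| ≤ |f u| + 1 := by
      have := abs_sub_abs_le_abs_sub (f w) (f u)
      have := hf u w huw
      rw [abs_sub_comm] at this
      linarith
    obtain ⟨J, hJ, hb⟩ := ih (by linarith)
    refine ⟨_, hJ.cons huw, ?_⟩
    have h2 : |f u * (g w - g u)| ≤ F * M := by
      rw [abs_mul, abs_sub_comm (g w)]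
      have : (0:ℝ) ≤ n := n.cast_nonneg
      exact mul_le_mul (by linarith) (hg u w huw) (abs_nonneg _)
        (by linarith [abs_nonneg (f u)])
    push_cast
    linarith [abs_add_le (f u * (g w - g u)) J]

theorem PathIntegral.of_zero (q : ℕ → V) (n : ℕ) (hq : ∀ i < n, adj (q i) (q (i + 1)))
    (h0 : ∀ i < n, f (q i) = 0) : PathIntegral adj f g (q 0) (q n) n 0 := by
  induction n with
  | zero => exact .nil _
  | succ n ih =>
    have := (ih (fun i hi => hq i (by lia)) (fun i hi => h0 i (by lia))).trans
      (.single (f := f) (g := g) (hq n (by lia)))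
    simpa [h0 n (by lia)] using this

/-- A symmetric connected graph in which the integral of `f dg` over a loop, for `1`-Lipschitz
functions `f` and `g`, is bounded linearly in the length of the loop. -/
structure HasLinearIntegrals (adj : V → V → Prop) (C : ℝ) : Prop where
  symm : ∀ u v, adj u v → adj v u
  conn : ∀ u v, ∃ n, IsPath adj u v n
  integral : ∀ f g : V → ℝ, (∀ u v, adj u v → |f u - f v| ≤ 1) →
    (∀ u v, adj u v → |g u - g v| ≤ 1) → ∀ u n J, PathIntegral adj f g u u n J →
      |J| ≤ C * (n + 1)

theorem PathIntegral.const_mul {u v : V} {n : ℕ} {J : ℝ} (c : ℝ)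
    (h : PathIntegral adj f g u v n J) :
    PathIntegral adj f (fun x => c * g x) u v n (c * J) := by
  induction h with
  | nil => rw [mul_zero]; exact .nil _
  | @cons u w v n J huw _ ih =>
    have := ih.cons huw
    convert this using 1
    ring

theorem HasLinearIntegrals.integral_le {C : ℝ} (h : HasLinearIntegrals adj C) {M : ℝ} (hM : 0 < M)
    (hf : ∀ u v, adj u v → |f u - f v| ≤ 1) (hg : ∀ u v, adj u v → |g u - g v| ≤ M)
    {u : V} {n : ℕ} {J : ℝ} (hJ : PathIntegral adj f g u u n J) : |J| ≤ M * (C * (n + 1)) := by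
  have := h.integral f (fun x => M⁻¹ * g x) hf (fun u v huv => by
    rw [← mul_sub, abs_mul, abs_of_pos (inv_pos.2 hM), inv_mul_le_iff₀ hM]
    simpa using hg u v huv) u n _ (hJ.const_mul M⁻¹)
  rwa [abs_mul, abs_of_pos (inv_pos.2 hM), inv_mul_le_iff₀ hM] at this

/-- The graph distance from `v` to the set `Z`. -/
noncomputable def setDist (adj : V → V → Prop) (Z : Set V) (v : V) : ℕ :=
  sInf {n | ∃ z ∈ Z, IsPath adj v z n}

theorem setDist_le {Z : Set V} {v z : V} {n : ℕ} (hz : z ∈ Z) (h : IsPath adj v z n) :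
    setDist adj Z v ≤ n := Nat.sInf_le ⟨z, hz, h⟩

theorem setDist_eq_zero {Z : Set V} {v : V} (hv : v ∈ Z) : setDist adj Z v = 0 :=
  Nat.le_zero.1 (setDist_le hv (.nil v))

theorem HasLinearIntegrals.exists_isPath_setDist {C : ℝ} (hL : HasLinearIntegrals adj C)
    {Z : Set V} (hZ : Z.Nonempty) (v : V) :
    ∃ z ∈ Z, IsPath adj v z (setDist adj Z v) := by
  obtain ⟨z, hz⟩ := hZ
  obtain ⟨n, hn⟩ := hL.conn v z
  exact Nat.sInf_mem (s := {n | ∃ z ∈ Z, IsPath adj v z n}) ⟨n, z, hz, hn⟩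

theorem HasLinearIntegrals.setDist_le_add_one {C : ℝ} (hL : HasLinearIntegrals adj C)
    {Z : Set V} (hZ : Z.Nonempty) {u v : V}
    (h : adj u v) : setDist adj Z u ≤ setDist adj Z v + 1 := by
  obtain ⟨z, hz, hp⟩ := hL.exists_isPath_setDist hZ v
  exact setDist_le hz (hp.cons h)

theorem HasLinearIntegrals.abs_setDist_sub_le {C : ℝ} (hL : HasLinearIntegrals adj C)
    {Z : Set V} (hZ : Z.Nonempty) {u v : V}
    (h : adj u v) : |(setDist adj Z u : ℝ) - setDist adj Z v| ≤ 1 := by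
  have h1 : (setDist adj Z u : ℝ) ≤ setDist adj Z v + 1 := by
    exact_mod_cast hL.setDist_le_add_one hZ h
  have h2 : (setDist adj Z v : ℝ) ≤ setDist adj Z u + 1 := by
    exact_mod_cast hL.setDist_le_add_one hZ (hL.symm _ _ h)
  rw [abs_le]
  constructor <;> linarith

/-- A path on which the pseudo-distance `s` grows linearly and is coarsely monotone. -/
structure IsTame (adj : V → V → Prop) (s : V → V → ℝ) (b : ℝ) (p : ℕ → V) (n : ℕ) : Prop where
  step : ∀ i < n, adj (p i) (p (i + 1))
  lower : ∀ i j, i ≤ j → j ≤ n → (j : ℝ) - i - b ≤ s (p i) (p j)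
  mono : ∀ i j k, i ≤ j → j ≤ k → k ≤ n → s (p i) (p j) ≤ s (p i) (p k) + b

/-- A function of two variables that is bounded on the diagonal and Lipschitz in the second
variable. -/
structure IsCoarseDist (adj : V → V → Prop) (s : V → V → ℝ) (b M : ℝ) : Prop where
  self : ∀ u, s u u ≤ b
  lip : ∀ x u v, adj u v → |s x u - s x v| ≤ M

theorem IsTame.shift {s : V → V → ℝ} {b : ℝ} {p : ℕ → V} {n : ℕ} (h : IsTame adj s b p n)
    {i j : ℕ} (hij : i ≤ j) (hj : j ≤ n) : IsTame adj s b (fun l => p (i + l)) (j - i) where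
  step l hl := h.step (i + l) (by lia)
  lower k l hkl hl := by
    have := h.lower (i + k) (i + l) (by lia) (by lia)
    push_cast at this
    linarith
  mono k l m hkl hlm hm := h.mono _ _ _ (by lia) (by lia) (by lia)

/-- Along a tame path g rises almost steadily to about n while f is at least A, so the integral is
about A·n. The backtracking of g is at most b below its running maximum, and f changes by at most 1
per step, so backtracking costs only b per step. -/
theorem IsTame.exists_pathIntegral {s : V → V → ℝ} {b M : ℝ} {p : ℕ → V} {n : ℕ} (hb : 0 ≤ b)
    (hs : IsCoarseDist adj s b M) (h : IsTame adj s b p n)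
    (hf : ∀ u v, adj u v → |f u - f v| ≤ 1) {A : ℝ} (hA : 0 ≤ A)
    (hfA : ∀ l < n, A ≤ f (p l)) (hn : f (p n) ≤ A) :
    ∃ J, PathIntegral adj f (s (p 0)) (p 0) (p n) n J ∧ A * (n - 2 * b) - b * A - b * n ≤ J := by
  set g := s (p 0) with hg
  -- Summation by parts against the running maximum m of g: new maxima contribute at least A times
  -- their increase, and f·(m - g) is the debt of the current backtracking.
  have key : ∀ j ≤ n, ∃ J m, PathIntegral adj f g (p 0) (p j) j J ∧ (∀ i ≤ j, g (p i) ≤ m) ∧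
      (∃ i ≤ j, m = g (p i)) ∧
      A * (m - g (p 0)) - f (p j) * (m - g (p j)) - b * j ≤ J := by
    intro j
    induction j with
    | zero =>
      intro _
      exact ⟨0, g (p 0), .nil _, by simp, ⟨0, le_rfl, rfl⟩, by simp⟩
    | succ j ih =>
      intro hj
      obtain ⟨J, m, hJ, hm, ⟨i, hi, rfl⟩, hle⟩ := ih (by lia)
      have hstep := h.step j (by lia)
      refine ⟨_, max (g (p i)) (g (p (j + 1))), hJ.trans (.single hstep), ?_, ?_, ?_⟩
      · intro l hl
        rcases Nat.lt_or_ge j l with h' | h'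
        · obtain rfl : l = j + 1 := by lia
          exact le_max_right _ _
        · exact (hm l h').trans (le_max_left _ _)
      · rcases max_choice (g (p i)) (g (p (j + 1))) with h' | h' <;> rw [h']
        · exact ⟨i, by lia, rfl⟩
        · exact ⟨j + 1, le_rfl, rfl⟩
      · have hmono : g (p i) ≤ g (p (j + 1)) + b := h.mono 0 i (j + 1) (by lia) (by lia) hj
        have hfj := hfA j (by lia)
        have hlip := abs_le.1 (hf _ _ hstep)
        push_cast
        rcases le_total (g (p i)) (g (p (j + 1))) with h' | h'
        · rw [max_eq_right h']
          nlinarith [mul_nonneg (sub_nonneg.2 hfj) (sub_nonneg.2 h')]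
        · rw [max_eq_left h']
          nlinarith [mul_nonneg (sub_nonneg.2 hlip.2) (sub_nonneg.2 h'), hlip.1]
  obtain ⟨J, m, hJ, hm, ⟨i, hi, rfl⟩, hle⟩ := key n le_rfl
  refine ⟨J, hJ, ?_⟩
  have h1 : g (p i) ≤ g (p n) + b := h.mono 0 i n (by lia) hi le_rfl
  have h2 := hm n le_rfl
  have h3 := h.lower 0 n (by lia) le_rfl
  have h4 := hs.self (p 0)
  rw [← hg] at h3 h4
  push_cast at h3
  have h5 : A * (n - 2 * b) ≤ A * (g (p i) - g (p 0)) :=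
    mul_le_mul_of_nonneg_left (by linarith) hA
  have h6 : f (p n) * (g (p i) - g (p n)) ≤ A * b :=
    mul_le_mul hn (by linarith) (by linarith) hA
  linarith

/-- A loop made of a tame side `p`, two sides `q`, `r` far from `p`, and three short connectors:
the length of `p` is controlled linearly by the lengths of `q` and `r`. -/
theorem IsTame.hexagon_le {C : ℝ} (hL : HasLinearIntegrals adj C) {s : V → V → ℝ} {b M : ℝ}
    (hb : 0 ≤ b) (hM : 0 < M) (hC : 0 ≤ C) (hs : IsCoarseDist adj s b M)
    {p q r : ℕ → V} {l m n : ℕ} (hp : IsTame adj s b p l)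
    (hq : ∀ i < m, adj (q i) (q (i + 1))) (hr : ∀ i < n, adj (r i) (r (i + 1))) {A : ℕ}
    (hpq : ∃ k ≤ A, IsPath adj (p l) (q 0) k) (hqr : ∃ k ≤ A, IsPath adj (q m) (r 0) k)
    (hrp : ∃ k ≤ A, IsPath adj (r n) (p 0) k)
    (farq : ∀ i < l, ∀ j ≤ m, ∀ k, IsPath adj (p i) (q j) k → A ≤ k)
    (farr : ∀ i < l, ∀ j ≤ n, ∀ k, IsPath adj (p i) (r j) k → A ≤ k) :
    A * (l - 2 * b) - b * A - b * l - 6 * A * A * M ≤ M * (C * (l + m + n + 3 * A + 1)) := by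
  set Z : Set V := {v | (∃ j ≤ m, v = q j) ∨ ∃ j ≤ n, v = r j} with hZd
  have hqZ : ∀ j ≤ m, q j ∈ Z := fun j hj => Or.inl ⟨j, hj, rfl⟩
  have hrZ : ∀ j ≤ n, r j ∈ Z := fun j hj => Or.inr ⟨j, hj, rfl⟩
  have hZ : Z.Nonempty := ⟨q 0, hqZ 0 (by lia)⟩
  set f : V → ℝ := fun v => setDist adj Z v with hf
  have hf1 : ∀ u v, adj u v → |f u - f v| ≤ 1 := fun u v h => hL.abs_setDist_sub_le hZ h
  have hq0 : ∀ j ≤ m, f (q j) = 0 := fun j hj => by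
    simp only [hf]; exact_mod_cast setDist_eq_zero (hqZ j hj)
  have hr0 : ∀ j ≤ n, f (r j) = 0 := fun j hj => by
    simp only [hf]; exact_mod_cast setDist_eq_zero (hrZ j hj)
  obtain ⟨k₁, hk₁, h₁⟩ := hpq
  obtain ⟨k₂, hk₂, h₂⟩ := hqr
  obtain ⟨k₃, hk₃, h₃⟩ := hrp
  have hend : f (p l) ≤ A := by
    simp only [hf]
    exact_mod_cast (setDist_le (hqZ 0 (by lia)) h₁).trans hk₁
  have hend0 : 0 ≤ f (p l) := Nat.cast_nonneg _
  have hA0 : (0:ℝ) ≤ A := A.cast_nonneg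
  obtain ⟨J, hJ, hJle⟩ := hp.exists_pathIntegral hb hs hf1 (A := A) hA0 (fun i hi => by
    obtain ⟨z, hz, hpz⟩ := hL.exists_isPath_setDist hZ (p i)
    simp only [hf]
    rcases hz with ⟨j, hj, rfl⟩ | ⟨j, hj, rfl⟩
    · exact_mod_cast farq i hi j hj _ hpz
    · exact_mod_cast farr i hi j hj _ hpz) hend
  have hg := hs.lip (p 0)
  have hkA : ∀ k : ℕ, k ≤ A → (k : ℝ) ≤ A := fun k hk => by exact_mod_cast hk
  -- Each connector starts where f ≤ A and has length at most A, so f ≤ 2A along it and its integral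
  -- is at most 2A²M.
  obtain ⟨J₁, hJ₁, hb₁⟩ := h₁.exists_pathIntegral (F := 2 * A) hf1 hg
    (by rw [abs_of_nonneg hend0]; linarith [hkA _ hk₁])
  obtain ⟨J₂, hJ₂, hb₂⟩ := h₂.exists_pathIntegral (F := 2 * A) hf1 hg
    (by rw [hq0 m le_rfl, abs_zero]; linarith [hkA _ hk₂])
  obtain ⟨J₃, hJ₃, hb₃⟩ := h₃.exists_pathIntegral (F := 2 * A) hf1 hg
    (by rw [hr0 n le_rfl, abs_zero]; linarith [hkA _ hk₃])
  have hloop := ((((hJ.trans hJ₁).trans (.of_zero q m hq fun i hi => hq0 i hi.le)).trans hJ₂).trans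
    (.of_zero r n hr fun i hi => hr0 i hi.le)).trans hJ₃
  have hint := hL.integral_le hM hf1 hg hloop
  have hconn : ∀ (k : ℕ) (x : ℝ), k ≤ A → |x| ≤ k * (2 * A * M) → -(2 * A * A * M) ≤ x := by
    intro k x hk hx
    have : (k : ℝ) * (2 * A * M) ≤ A * (2 * A * M) :=
      mul_le_mul_of_nonneg_right (hkA k hk) (by positivity)
    linarith [neg_abs_le x]
  have e₁ := hconn _ _ hk₁ hb₁
  have e₂ := hconn _ _ hk₂ hb₂
  have e₃ := hconn _ _ hk₃ hb₃
  have hint' := (le_abs_self _).trans hint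
  push_cast at hint'
  have hmono : M * (C * (l + k₁ + m + k₂ + n + k₃ + 1 : ℝ)) ≤
      M * (C * (l + m + n + 3 * A + 1)) := by
    refine mul_le_mul_of_nonneg_left (mul_le_mul_of_nonneg_left ?_ hC) hM.le
    linarith [hkA _ hk₁, hkA _ hk₂, hkA _ hk₃]
  linarith

end PathIntegrals

/-! ### Thinness of bigons and triangles with tame sides. -/

section ThinTriangles

variable {V : Type*} {adj : V → V → Prop} {s : V → V → ℝ} {b M C : ℝ}

theorem IsTame.length_le_of_isPath (hL : HasLinearIntegrals adj C)
    (hs : IsCoarseDist adj s b M) {β : ℕ → V} {m : ℕ} (hβ : IsTame adj s b β m) {i j : ℕ}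
    (hij : i ≤ j) (hj : j ≤ m) {k : ℕ} (hk : IsPath adj (β i) (β j) k) :
    (j : ℝ) - i ≤ k * M + 2 * b := by
  have h1 := (abs_le.1 ((hk.symm hL.symm).lipschitz (hs.lip (β i)))).2
  linarith [hβ.lower i j hij hj, hs.self (β i)]

/-- The piece of β between the two feet is tame, so its length is at most about M times the length
of the detour through p. The hexagon inequality with a constant third side then bounds A·n by a
smaller multiple of n plus a constant; the lower bound on A leaves a coefficient of at least 1. -/
theorem IsTame.bigon_le (hL : HasLinearIntegrals adj C) (hb : 0 ≤ b) (hM : 0 < M) (hC : 0 ≤ C)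
    (hs : IsCoarseDist adj s b M) {A : ℕ} (hA : b + M * C * (1 + M) + 1 ≤ A)
    {p β : ℕ → V} {n m : ℕ} (hp : IsTame adj s b p n) (hβ : IsTame adj s b β m)
    (far : ∀ i < n, ∀ j ≤ m, ∀ k, IsPath adj (p i) (β j) k → A ≤ k) {i j : ℕ} (hi : i ≤ m)
    (hj : j ≤ m) (hpi : ∃ k ≤ A, IsPath adj (p 0) (β i) k)
    (hpj : ∃ k ≤ A, IsPath adj (p n) (β j) k) :
    (n : ℝ) ≤ 3 * b * A + 6 * A * A * M + M * C * (2 * A * M + 2 * b + 3 * A + 1) := by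
  have hlen : ∃ q : ℕ → V, ∃ l : ℕ, (∀ i < l, adj (q i) (q (i + 1))) ∧ q 0 = β j ∧ q l = β i ∧
      (∀ i ≤ l, ∃ j ≤ m, q i = β j) ∧ (l : ℝ) ≤ (2 * A + n) * M + 2 * b := by
    obtain ⟨k₁, hk₁, h₁⟩ := hpi
    obtain ⟨k₂, hk₂, h₂⟩ := hpj
    have hpn : IsPath adj (p 0) (p n) n := by
      have : ∀ l ≤ n, IsPath adj (p 0) (p l) l := fun l => by
        induction l with
        | zero => exact fun _ => .nil _
        | succ l ih => exact fun hl => (ih (by lia)).trans (.single (hp.step l (by lia)))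
      exact this n le_rfl
    have hpath := ((h₁.symm hL.symm).trans hpn).trans h₂
    have hk : ((k₁ + n + k₂ : ℕ) : ℝ) * M ≤ (2 * A + n) * M := by
      refine mul_le_mul_of_nonneg_right ?_ hM.le
      exact_mod_cast (by lia : k₁ + n + k₂ ≤ 2 * A + n)
    rcases le_total i j with hij | hij
    · refine ⟨fun l => β (j - l), j - i, fun l hl => ?_, rfl, ?_, fun l hl => ⟨j - l, by lia, rfl⟩,
        ?_⟩
      · have := hβ.step (j - (l + 1)) (by lia)
        rw [show j - (l + 1) + 1 = j - l by lia] at this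
        exact hL.symm _ _ this
      · exact congrArg β (by lia)
      · rw [Nat.cast_sub hij]
        linarith [hβ.length_le_of_isPath hL hs hij hj hpath]
    · refine ⟨fun l => β (j + l), i - j, fun l hl => hβ.step _ (by lia), rfl, ?_,
        fun l hl => ⟨j + l, by lia, rfl⟩, ?_⟩
      · exact congrArg β (by lia)
      · rw [Nat.cast_sub hij]
        linarith [hβ.length_le_of_isPath hL hs hij hi (hpath.symm hL.symm)]
  obtain ⟨q, l, hq, hq0, hql, hqβ, hl⟩ := hlen
  have key := hp.hexagon_le hL hb hM hC hs hq (r := fun _ => β i) (n := 0) (by simp) (A := A)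
    (by rwa [hq0]) ⟨0, by lia, by rw [hql]; exact .nil _⟩
    (by
      obtain ⟨k, hk, h⟩ := hpi
      exact ⟨k, hk, h.symm hL.symm⟩)
    (fun a ha c hc k hk => by
      obtain ⟨d, hd, he⟩ := hqβ c hc
      exact far a ha d hd k (he ▸ hk))
    (fun a ha c hc k hk => far a ha i hi k hk)
  have h1 : M * C * l ≤ M * C * ((2 * A + n) * M + 2 * b) :=
    mul_le_mul_of_nonneg_left hl (by positivity)
  have h2 : (b + M * C * (1 + M) + 1) * n ≤ A * n :=
    mul_le_mul_of_nonneg_right hA n.cast_nonneg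
  push_cast at key
  linarith

/-- Cutting β and γ where they first come close leaves a hexagon whose three long sides are mutually
far apart. The hexagon inequality for each side in turn, summed, bounds A times the total length by
3MC times the total length plus a constant. -/
theorem IsTame.triangle_le (hL : HasLinearIntegrals adj C) (hb : 0 ≤ b) (hM : 0 < M) (hC : 0 ≤ C)
    (hs : IsCoarseDist adj s b M) {A : ℕ} (hA : b + 3 * M * C + 1 ≤ A)
    {p β γ : ℕ → V} {n m l : ℕ} (hp : IsTame adj s b p n) (hβ : IsTame adj s b β m)
    (hγ : IsTame adj s b γ l) (hend : β m = γ l)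
    (farβ : ∀ i ≤ n, ∀ j ≤ m, ∀ k, IsPath adj (p i) (β j) k → A ≤ k)
    (farγ : ∀ i ≤ n, ∀ j ≤ l, ∀ k, IsPath adj (p i) (γ j) k → A ≤ k)
    {i j : ℕ} (hi : i ≤ m) (hj : j ≤ l) (hpi : ∃ k ≤ A, IsPath adj (p 0) (β i) k)
    (hpj : ∃ k ≤ A, IsPath adj (p n) (γ j) k) :
    (n : ℝ) ≤ 9 * b * A + 18 * A * A * M + 3 * (M * C) * (3 * A + 1) := by
  classical
  have symmPath : ∀ {u v}, (∃ k ≤ A, IsPath adj u v k) → ∃ k ≤ A, IsPath adj v u k :=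
    fun ⟨k, hk, h⟩ => ⟨k, hk, h.symm hL.symm⟩
  -- Minimality of i' + j' keeps the two remaining pieces at distance at least A, except for the
  -- final pair of endpoints. The hexagon inequality tolerates this because its tame side is only
  -- required to be far at indices below its last one.
  let Q : ℕ → Prop := fun N => ∃ i' j', i ≤ i' ∧ i' ≤ m ∧ j ≤ j' ∧ j' ≤ l ∧ i' + j' = N ∧
    ∃ k ≤ A, IsPath adj (β i') (γ j') k
  have hQ : ∃ N, Q N := ⟨m + l, m, l, hi, le_rfl, hj, le_rfl, rfl, 0, by lia, by
    rw [hend]; exact .nil _⟩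
  obtain ⟨i', j', hii', hi'm, hjj', hj'l, hN, hnear⟩ := Nat.find_spec hQ
  have hmin : ∀ a c, i ≤ a → a ≤ i' → j ≤ c → c ≤ j' → a + c < i' + j' →
      ∀ k, IsPath adj (β a) (γ c) k → A ≤ k := by
    intro a c h1 h2 h3 h4 h5 k hk
    by_contra hlt
    exact Nat.find_min hQ (hN ▸ h5) ⟨a, c, h1, by lia, h3, by lia, rfl, k, by lia, hk⟩
  have hrev : ∀ {δ : ℕ → V} {N e : ℕ}, IsTame adj s b δ N → e ≤ N →
      ∀ a < e, adj (δ (e - a)) (δ (e - (a + 1))) := by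
    intro δ N e hδ he a ha
    have := hδ.step (e - (a + 1)) (by lia)
    rw [show e - (a + 1) + 1 = e - a by lia] at this
    exact hL.symm _ _ this
  have k₁ := hp.hexagon_le hL hb hM hC hs (q := fun a => γ (j + a)) (m := j' - j)
    (r := fun a => β (i' - a)) (n := i' - i) (A := A)
    (fun a ha => hγ.step _ (by lia)) (fun a ha => hrev hβ hi'm a (by lia)) hpj
    (by simpa [show j + (j' - j) = j' by lia] using symmPath hnear)
    (by simpa [show i' - (i' - i) = i by lia] using symmPath hpi)
    (fun a ha c hc => farγ a ha.le _ (by lia)) (fun a ha c hc => farβ a ha.le _ (by lia))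
  have k₂ := (hγ.shift hjj' hj'l).hexagon_le hL hb hM hC hs (q := fun a => β (i' - a))
    (m := i' - i) (r := p) (n := n) (A := A)
    (fun a ha => hrev hβ hi'm a (by lia)) hp.step
    (by simpa [show j + (j' - j) = j' by lia] using symmPath hnear)
    (by simpa [show i' - (i' - i) = i by lia] using symmPath hpi) hpj
    (fun a ha c hc k hk => hmin _ _ (by lia) (by lia) (by lia) (by lia) (by lia) k
      (hk.symm hL.symm))
    (fun a ha c hc k hk => farγ c hc _ (by lia) k (hk.symm hL.symm))
  have k₃ := (hβ.shift hii' hi'm).hexagon_le hL hb hM hC hs (q := fun a => γ (j' - a))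
    (m := j' - j) (r := fun a => p (n - a)) (n := n) (A := A)
    (fun a ha => hrev hγ hj'l a (by lia)) (fun a ha => hrev hp le_rfl a ha)
    (by simpa [show i + (i' - i) = i' by lia] using hnear)
    (by simpa [show j' - (j' - j) = j by lia] using symmPath hpj) (by simpa using hpi)
    (fun a ha c hc k hk => hmin _ _ (by lia) (by lia) (by lia) (by lia) (by lia) k hk)
    (fun a ha c hc k hk => farβ (n - c) (by lia) _ (by lia) k (hk.symm hL.symm))
  generalize hx : ((i' - i : ℕ) : ℝ) = x at *
  generalize hy : ((j' - j : ℕ) : ℝ) = y at *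
  have hx0 : 0 ≤ x := hx ▸ Nat.cast_nonneg _
  have hy0 : 0 ≤ y := hy ▸ Nat.cast_nonneg _
  have hn0 : (0:ℝ) ≤ n := n.cast_nonneg
  have h2 : (b + 3 * M * C + 1) * (n + x + y) ≤ A * (n + x + y) :=
    mul_le_mul_of_nonneg_right hA (by linarith)
  linarith

/-- Triangles with tame sides are uniformly thin. -/
theorem HasLinearIntegrals.exists_thin (hL : HasLinearIntegrals adj C) (hb : 0 ≤ b) (hM : 0 < M)
    (hC : 0 ≤ C) (hs : IsCoarseDist adj s b M) :
    ∃ R : ℕ, ∀ (α β γ : ℕ → V) (n m l : ℕ), IsTame adj s b α n → IsTame adj s b β m →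
      IsTame adj s b γ l → β m = γ l →
      ∀ U : Set V, U = {v | (∃ j ≤ m, v = β j) ∨ ∃ j ≤ l, v = γ j} → α 0 ∈ U → α n ∈ U →
      ∀ i ≤ n, ∃ u ∈ U, ∃ k ≤ R, IsPath adj (α i) u k := by
  classical
  obtain ⟨A, hA⟩ := exists_nat_ge (b + M * C * (1 + M) + 3 * M * C + 1)
  have hMC : 0 ≤ M * C := by positivity
  have hA₁ : b + M * C * (1 + M) + 1 ≤ A := by linarith
  have hA₂ : b + 3 * M * C + 1 ≤ A := by nlinarith
  obtain ⟨N, hN⟩ := exists_nat_ge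
    (max (3 * b * A + 6 * A * A * M + M * C * (2 * A * M + 2 * b + 3 * A + 1))
      (9 * b * A + 18 * A * A * M + 3 * (M * C) * (3 * A + 1)))
  have hN₁ := (le_max_left _ _).trans hN
  have hN₂ := (le_max_right _ _).trans hN
  refine ⟨A + N, fun α β γ n m l hα hβ hγ hend U hU h0 hn i hi => ?_⟩
  have hUne : U.Nonempty := ⟨_, h0⟩
  set f := setDist adj U with hf
  suffices h : f (α i) ≤ A + N by
    obtain ⟨u, hu, hp⟩ := hL.exists_isPath_setDist hUne (α i)
    exact ⟨u, hu, _, h, hp⟩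
  by_contra! hgt
  -- The segment around i on which f > A is cut off at the nearest indices where f ≤ A. There f is
  -- exactly A, since f moves by at most 1 per step, so the whole segment is far from U while its
  -- ends are near it.
  have hlast : ∃ j, i + j ≤ n ∧ f (α (i + j)) ≤ A := ⟨n - i, by lia, by
    rw [show i + (n - i) = n by lia, hf, setDist_eq_zero hn]; lia⟩
  have hfirst : ∃ j, j ≤ i ∧ f (α (i - j)) ≤ A := ⟨i, le_rfl, by
    rw [Nat.sub_self, hf, setDist_eq_zero h0]; lia⟩
  set e := Nat.find hlast
  set d := Nat.find hfirst
  obtain ⟨he, hfe⟩ := Nat.find_spec hlast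
  obtain ⟨hd, hfd⟩ := Nat.find_spec hfirst
  have hdpos : 0 < d := by
    rcases Nat.eq_zero_or_pos d with h | h
    · change f (α (i - d)) ≤ A at hfd
      rw [h, Nat.sub_zero] at hfd
      lia
    · exact h
  have hepos : 0 < e := by
    rcases Nat.eq_zero_or_pos e with h | h
    · change f (α (i + e)) ≤ A at hfe
      rw [h, Nat.add_zero] at hfe
      lia
    · exact h
  change d ≤ i at hd
  change i + e ≤ n at he
  change f (α (i + e)) ≤ A at hfe
  change f (α (i - d)) ≤ A at hfd
  have hin : ∀ a, i - d < a → a < i + e → A < f (α a) := by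
    intro a h1 h2
    by_contra! h3
    rcases le_total a i with h | h
    · exact Nat.find_min hfirst (m := i - a) (by change i - a < d; lia)
        ⟨by lia, by rwa [show i - (i - a) = a by lia]⟩
    · exact Nat.find_min hlast (m := a - i) (by change a - i < e; lia)
        ⟨by lia, by rwa [show i + (a - i) = a by lia]⟩
  have hstepf : ∀ a < n, f (α a) ≤ f (α (a + 1)) + 1 ∧ f (α (a + 1)) ≤ f (α a) + 1 := fun a ha =>
    ⟨hL.setDist_le_add_one hUne (hα.step a ha),
      hL.setDist_le_add_one hUne (hL.symm _ _ (hα.step a ha))⟩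
  have hall : ∀ a, i - d ≤ a → a ≤ i + e → A ≤ f (α a) := by
    intro a h1 h2
    rcases h1.eq_or_lt with h | h
    · have := hin (a + 1) (by lia) (by lia)
      have := (hstepf a (by lia)).2
      lia
    rcases h2.eq_or_lt with h' | h'
    · have := hin (a - 1) (by lia) (by lia)
      have := (hstepf (a - 1) (by lia)).1
      rw [show a - 1 + 1 = a by lia] at this
      lia
    exact (hin a h h').le
  have hshort : (i + e) - (i - d) ≤ N := by
    have hp := hα.shift (show i - d ≤ i + e by lia) he
    set p := fun a => α (i - d + a) with hpd
    set L := (i + e) - (i - d) with hLd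
    have hfar : ∀ a ≤ L, ∀ u ∈ U, ∀ k, IsPath adj (p a) u k → A ≤ k := fun a ha u hu k hk =>
      (hall (i - d + a) (by lia) (by lia)).trans (setDist_le hu hk)
    have farβ : ∀ a ≤ L, ∀ c ≤ m, ∀ k, IsPath adj (p a) (β c) k → A ≤ k := fun a ha c hc =>
      hfar a ha _ (by rw [hU]; exact Or.inl ⟨c, hc, rfl⟩)
    have farγ : ∀ a ≤ L, ∀ c ≤ l, ∀ k, IsPath adj (p a) (γ c) k → A ≤ k := fun a ha c hc =>
      hfar a ha _ (by rw [hU]; exact Or.inr ⟨c, hc, rfl⟩)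
    obtain ⟨u, hu, hpu⟩ := hL.exists_isPath_setDist hUne (p 0)
    obtain ⟨v, hv, hpv⟩ := hL.exists_isPath_setDist hUne (p L)
    have hpu' : ∃ k ≤ A, IsPath adj (p 0) u k := ⟨_, hfd, hpu⟩
    have hpv' : ∃ k ≤ A, IsPath adj (p L) v k := ⟨_, by
      have : i - d + L = i + e := by lia
      simp only [hpd, this]
      exact hfe, hpv⟩
    clear_value p L
    have : (L : ℝ) ≤ N := by
      rw [hU] at hu hv
      rcases hu with ⟨c, hc, rfl⟩ | ⟨c, hc, rfl⟩ <;> rcases hv with ⟨c', hc', rfl⟩ | ⟨c', hc', rfl⟩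
      · exact (hp.bigon_le hL hb hM hC hs hA₁ hβ (fun a ha => farβ a ha.le) hc hc' hpu' hpv').trans
          hN₁
      · exact (hp.triangle_le hL hb hM hC hs hA₂ hβ hγ hend farβ farγ hc hc' hpu' hpv').trans hN₂
      · exact (hp.triangle_le hL hb hM hC hs hA₂ hγ hβ hend.symm farγ farβ hc hc' hpu' hpv').trans
          hN₂
      · exact (hp.bigon_le hL hb hM hC hs hA₁ hγ (fun a ha => farγ a ha.le) hc hc' hpu' hpv').trans
          hN₁
    exact_mod_cast this
  have hdecay : ∀ a, i + a ≤ n → f (α i) ≤ f (α (i + a)) + a := by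
    intro a
    induction a with
    | zero => simp
    | succ a ih =>
      intro ha
      have := (hstepf (i + a) (by lia)).1
      rw [add_assoc] at this
      have := ih (by lia)
      lia
  have := hdecay e he
  lia

end ThinTriangles

/-! ### Minimizing over words: the function `wordMin`. -/

section WordMinima

/-- The product of the images of the letters of a word. -/
def wordProd {E ι : Type*} [Group E] (t : ι → E) (w : List ι) : E := (w.map t).prod

variable {E Γ ι : Type*} [Group E] [Group Γ]

@[simp] theorem wordProd_nil (t : ι → E) : wordProd t [] = 1 := rfl

@[simp] theorem wordProd_cons (t : ι → E) (i : ι) (w : List ι) :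
    wordProd t (i :: w) = t i * wordProd t w := by simp [wordProd]

@[simp] theorem wordProd_append (t : ι → E) (v w : List ι) :
    wordProd t (v ++ w) = wordProd t v * wordProd t w := by simp [wordProd]

theorem map_wordProd (π : E →* Γ) (t : ι → E) (w : List ι) :
    π (wordProd t w) = wordProd (fun i => π (t i)) w := by
  simp [wordProd, map_list_prod, Function.comp_def]

/-- `φ` is a conjugation-quasi-invariant quasimorphism on `ker π`. -/
structure IsKernelQuasimorphism (π : E →* Γ) (φ : E → ℝ) (D : ℝ) : Prop where
  mul : ∀ k l, π k = 1 → π l = 1 → |φ (k * l) - φ k - φ l| ≤ D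
  conj : ∀ g k, π k = 1 → |φ (g * k * g⁻¹) - φ k| ≤ D

/-- `φ` is a conjugation-quasi-invariant quasimorphism on `ker π`, and it grows at most linearly on
the words in the letters `t` that represent elements of `ker π`. -/
structure IsLinearOnKernel (π : E →* Γ) (φ : E → ℝ) (t : ι → E) (D C : ℝ) : Prop
    extends IsKernelQuasimorphism π φ D where
  exists_inv : ∀ i, ∃ j, π (t i) * π (t j) = 1
  surj : ∀ γ, ∃ w : List ι, π (wordProd t w) = γ
  linear : ∀ w : List ι, π (wordProd t w) = 1 → |φ (wordProd t w)| ≤ C * (w.length + 1)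

/-- The infimum of `φ (w⁻¹ * g) + c * |w|` over the words `w` with the same image as `g`. -/
noncomputable def wordMin (π : E →* Γ) (φ : E → ℝ) (t : ι → E) (c : ℝ) (g : E) : ℝ :=
  sInf {r | ∃ w : List ι, π (wordProd t w) = π g ∧ r = φ ((wordProd t w)⁻¹ * g) + c * w.length}

namespace IsKernelQuasimorphism

variable {π : E →* Γ} {φ : E → ℝ} {D : ℝ}

theorem abs_one (h : IsKernelQuasimorphism π φ D) : |φ 1| ≤ D := by
  have := h.mul 1 1 (map_one π) (map_one π)
  rwa [mul_one, sub_self, zero_sub, abs_neg] at this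

theorem nonneg (h : IsKernelQuasimorphism π φ D) : 0 ≤ D := (abs_nonneg _).trans h.abs_one

theorem abs_inv (h : IsKernelQuasimorphism π φ D) {k : E} (hk : π k = 1) :
    |φ k⁻¹ + φ k| ≤ 2 * D := by
  have h1 := abs_le.1 (h.mul k k⁻¹ hk (by rw [map_inv, hk, inv_one]))
  rw [mul_inv_cancel] at h1
  have h2 := abs_le.1 h.abs_one
  exact abs_le.2 ⟨by linarith, by linarith⟩

end IsKernelQuasimorphism

namespace IsLinearOnKernel

variable {π : E →* Γ} {φ : E → ℝ} {t : ι → E} {D C : ℝ}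

/-- Since w⁻¹g = (vw)⁻¹(vg) with both factors in the kernel, the linear bound on vw applies. Thus
φ(w⁻¹g) decreases in |w| with slope at most C, which is why the penalty C + 1 makes the infimum
finite. -/
theorem lower_aux (h : IsLinearOnKernel π φ t D C) {v w : List ι} {g : E}
    (hw : π (wordProd t w) = π g) (hv : π (wordProd t v) * π g = 1) :
    φ (wordProd t v * g) - C * (v.length + w.length + 1) - 3 * D ≤ φ ((wordProd t w)⁻¹ * g) := by
  have hvw : π (wordProd t (v ++ w)) = 1 := by simpa [hw] using hv
  have h1 := h.linear _ hvw
  have h2 := h.abs_inv hvw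
  have h3 := h.mul (wordProd t (v ++ w))⁻¹ (wordProd t v * g) (by rw [map_inv, hvw, inv_one])
    (by rwa [map_mul])
  rw [show (wordProd t (v ++ w))⁻¹ * (wordProd t v * g) = (wordProd t w)⁻¹ * g by
    simp [mul_assoc]] at h3
  rw [abs_le] at h1 h2 h3
  rw [List.length_append] at h1
  push_cast at h1
  linarith

theorem bddBelow (h : IsLinearOnKernel π φ t D C) (g : E) :
    BddBelow {r | ∃ w : List ι, π (wordProd t w) = π g ∧
      r = φ ((wordProd t w)⁻¹ * g) + (C + 1) * w.length} := by
  obtain ⟨v, hv⟩ := h.surj (π g)⁻¹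
  refine ⟨φ (wordProd t v * g) - C * (v.length + 1) - 3 * D, ?_⟩
  rintro _ ⟨w, hw, rfl⟩
  have := h.lower_aux hw (by rw [hv, inv_mul_cancel])
  have hl : (0:ℝ) ≤ w.length := Nat.cast_nonneg _
  linarith

theorem wordMin_le (h : IsLinearOnKernel π φ t D C) {g : E} {w : List ι}
    (hw : π (wordProd t w) = π g) :
    wordMin π φ t (C + 1) g ≤ φ ((wordProd t w)⁻¹ * g) + (C + 1) * w.length :=
  csInf_le (h.bddBelow g) ⟨w, hw, rfl⟩

theorem exists_lt_wordMin (h : IsLinearOnKernel π φ t D C) (g : E) :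
    ∃ w : List ι, π (wordProd t w) = π g ∧
      φ ((wordProd t w)⁻¹ * g) + (C + 1) * w.length < wordMin π φ t (C + 1) g + 1 := by
  obtain ⟨w, hw⟩ := h.surj (π g)
  obtain ⟨_, ⟨v, hv, rfl⟩, hlt⟩ := Real.lt_sInf_add_pos (s := {r | ∃ w : List ι,
    π (wordProd t w) = π g ∧ r = φ ((wordProd t w)⁻¹ * g) + (C + 1) * w.length})
    ⟨_, w, hw, rfl⟩ one_pos
  exact ⟨v, hv, hlt⟩

/-- Concatenate near-minimizing words v for g and w for k: (vw)⁻¹gk is w⁻¹k times the conjugate of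
v⁻¹g by k⁻¹, so quasi-invariance enters here. -/
theorem wordMin_mul_le (h : IsLinearOnKernel π φ t D C) (g k : E) :
    wordMin π φ t (C + 1) (g * k) ≤
      wordMin π φ t (C + 1) g + wordMin π φ t (C + 1) k + (2 * D + 2) := by
  obtain ⟨v, hv, hvlt⟩ := h.exists_lt_wordMin g
  obtain ⟨w, hw, hwlt⟩ := h.exists_lt_wordMin k
  have h1 := h.wordMin_le (g := g * k) (w := v ++ w) (by simp [hv, hw])
  have hv' : π ((wordProd t v)⁻¹ * g) = 1 := by rw [map_mul, map_inv, hv, inv_mul_cancel]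
  have hw' : π ((wordProd t w)⁻¹ * k) = 1 := by rw [map_mul, map_inv, hw, inv_mul_cancel]
  have h2 := abs_le.1 (h.conj k⁻¹ _ hv')
  have h3 := abs_le.1 (h.mul ((wordProd t w)⁻¹ * k) (k⁻¹ * ((wordProd t v)⁻¹ * g) * k⁻¹⁻¹) hw'
    (by simp only [map_mul, hv', map_inv, mul_one, inv_inv, inv_mul_cancel]))
  rw [show (wordProd t w)⁻¹ * k * (k⁻¹ * ((wordProd t v)⁻¹ * g) * k⁻¹⁻¹) =
    (wordProd t (v ++ w))⁻¹ * (g * k) by simp [mul_assoc]] at h3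
  rw [List.length_append] at h1
  push_cast at h1
  linarith

theorem abs_wordMin_sub_le (h : IsLinearOnKernel π φ t D C) {k : E} (hk : π k = 1) :
    |wordMin π φ t (C + 1) k - φ k| ≤ C + 3 * D + 1 := by
  have hD := h.nonneg
  have h1 := h.wordMin_le (g := k) (w := []) (by simp [hk])
  simp only [wordProd_nil, inv_one, one_mul, List.length_nil,
    Nat.cast_zero, mul_zero, add_zero] at h1
  obtain ⟨w, hw, hlt⟩ := h.exists_lt_wordMin k
  have h2 := h.lower_aux (v := []) hw (by simp [hk])
  simp only [wordProd_nil, one_mul, List.length_nil,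
    Nat.cast_zero] at h2 hlt
  have hl : (0:ℝ) ≤ w.length := Nat.cast_nonneg _
  rw [abs_le]
  constructor <;> linarith

theorem wordMin_word_le (h : IsLinearOnKernel π φ t D C) (w : List ι) :
    wordMin π φ t (C + 1) (wordProd t w) ≤ (C + 1) * w.length + D := by
  have h1 := h.wordMin_le (g := wordProd t w) (w := w) rfl
  rw [inv_mul_cancel] at h1
  linarith [(abs_le.1 h.abs_one).2]

theorem wordMin_letter_le (h : IsLinearOnKernel π φ t D C) (i : ι) :
    wordMin π φ t (C + 1) (t i) ≤ C + 1 + D := by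
  simpa using h.wordMin_word_le [i]

theorem wordMin_letter_inv_le (h : IsLinearOnKernel π φ t D C) (i : ι) :
    wordMin π φ t (C + 1) (t i)⁻¹ ≤ 4 * C + 1 + 2 * D := by
  obtain ⟨j, hj⟩ := h.exists_inv i
  have hj' : π (wordProd t [i, j]) = 1 := by simpa using hj
  have h1 := h.wordMin_le (g := (t i)⁻¹) (w := [j])
    (by simpa using eq_inv_of_mul_eq_one_right hj)
  have h2 := abs_le.1 (h.linear _ hj')
  have h3 := abs_le.1 (h.abs_inv hj')
  have h4 : (wordProd t [j])⁻¹ * (t i)⁻¹ = (wordProd t [i, j])⁻¹ := by simp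
  rw [h4] at h1
  simp only [List.length_cons, List.length_nil] at h1 h2
  push_cast at h1 h2
  linarith

/-- The slope here is C, not C + 1. The spare 1 makes the symmetrized weight of a near-minimizing
word grow like its length. -/
theorem wordMin_word_inv_ge (h : IsLinearOnKernel π φ t D C) (w : List ι) :
    -(C * w.length) - (C + 4 * D + 1) ≤ wordMin π φ t (C + 1) (wordProd t w)⁻¹ := by
  obtain ⟨v, hv, hlt⟩ := h.exists_lt_wordMin (wordProd t w)⁻¹
  have h1 := h.lower_aux (v := w) hv (by rw [map_inv, mul_inv_cancel])
  rw [mul_inv_cancel] at h1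
  have h2 := abs_le.1 h.abs_one
  have hl : (0:ℝ) ≤ v.length := Nat.cast_nonneg _
  have hD := h.nonneg
  linarith

end IsLinearOnKernel

end WordMinima

/-! ### Coarse weights and the tame paths they produce. -/

section CoarseWeights

variable {E Γ ι : Type*} [Group E] [Group Γ]

/-- Adjacency in the right Cayley graph with respect to a family of elements. -/
def cayleyAdj (a : ι → Γ) (u v : Γ) : Prop := ∃ i, v = u * a i

/-- A coarsely subadditive function on `E` whose near-minimizing paths in the letters `t` have
uniform properties. -/
structure IsCoarseWeight (π : E →* Γ) (t : ι → E) (P : E → ℝ) (B c : ℝ) : Prop where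
  mul_le : ∀ g h, P (g * h) ≤ P g + P h + B
  ker_le : ∀ k, π k = 1 → P k + P k⁻¹ ≤ B
  letter_le : ∀ i, P (t i) + P (t i)⁻¹ ≤ B
  exists_word : ∀ g, ∃ w : List ι, π (wordProd t w) = π g ∧
    (∀ u v, w = u ++ v → P (wordProd t u) + P ((wordProd t u)⁻¹ * g) ≤ P g + B) ∧
    ∀ u v v', w = u ++ v ++ v' → |P (wordProd t v) - c * v.length| ≤ B ∧
      v.length - B ≤ P (wordProd t v) + P (wordProd t v)⁻¹

theorem IsLinearOnKernel.isCoarseWeight {π : E →* Γ} {φ : E → ℝ} {t : ι → E} {D C : ℝ}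
    (h : IsLinearOnKernel π φ t D C) (hC : 0 ≤ C) :
    IsCoarseWeight π t (wordMin π φ t (C + 1)) (10 * C + 20 * D + 20) (C + 1) where
  mul_le g k := by linarith [h.wordMin_mul_le g k, h.nonneg]
  ker_le k hk := by
    have h1 := abs_le.1 (h.abs_wordMin_sub_le hk)
    have h2 := abs_le.1 (h.abs_wordMin_sub_le (k := k⁻¹) (by rw [map_inv, hk, inv_one]))
    have h3 := abs_le.1 (h.abs_inv hk)
    linarith [h.nonneg]
  letter_le i := by linarith [h.wordMin_letter_le i, h.wordMin_letter_inv_le i, h.nonneg]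
  exists_word g := by
    obtain ⟨w, hw, hlt⟩ := h.exists_lt_wordMin g
    have hD := h.nonneg
    have hsuf : ∀ u v, w = u ++ v → wordMin π φ t (C + 1) ((wordProd t u)⁻¹ * g) ≤
        φ ((wordProd t w)⁻¹ * g) + (C + 1) * v.length := by
      rintro u v rfl
      have := h.wordMin_le (g := (wordProd t u)⁻¹ * g) (w := v) (by simp [← hw])
      rwa [← mul_assoc, ← mul_inv_rev, ← wordProd_append] at this
    refine ⟨w, hw, fun u v huv => ?_, fun u v v' huv => ?_⟩
    · have h1 := hsuf u v huv
      have h2 := h.wordMin_word_le u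
      rw [huv] at hlt h1
      rw [List.length_append] at hlt
      push_cast at hlt
      linarith
    · have h1 := hsuf _ _ huv
      have h2 := h.wordMin_word_le u
      have h3 := h.wordMin_word_le v
      have h4 := h.wordMin_mul_le (wordProd t (u ++ v)) ((wordProd t (u ++ v))⁻¹ * g)
      rw [mul_inv_cancel_left] at h4
      have h5 := h.wordMin_mul_le (wordProd t u) (wordProd t v)
      rw [← wordProd_append] at h5
      have h6 := h.wordMin_word_inv_ge v
      have hlen : (w.length : ℝ) = u.length + v.length + v'.length := by
        rw [huv, List.length_append, List.length_append]
        push_cast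
        ring
      rw [hlen] at hlt
      refine ⟨abs_le.2 ⟨by linarith, by linarith⟩, by linarith⟩

namespace IsCoarseWeight

variable {π : E →* Γ} {t : ι → E} {P : E → ℝ} {B c : ℝ}

theorem one_ge (h : IsCoarseWeight π t P B c) : -B ≤ P 1 := by
  have := h.mul_le 1 1
  rw [mul_one] at this
  linarith

theorem nonneg (h : IsCoarseWeight π t P B c) : 0 ≤ B := by
  have h1 := h.one_ge
  have h2 := h.ker_le 1 (map_one π)
  rw [inv_one] at h2
  linarith

theorem sym_mul_le (h : IsCoarseWeight π t P B c) (g k : E) :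
    P (g * k) + P (g * k)⁻¹ ≤ P g + P g⁻¹ + (P k + P k⁻¹) + 2 * B := by
  rw [mul_inv_rev]
  linarith [h.mul_le g k, h.mul_le k⁻¹ g⁻¹]

theorem sym_le_of_map_eq (h : IsCoarseWeight π t P B c) {g g' : E} (hg : π g = π g') :
    P g + P g⁻¹ ≤ P g' + P g'⁻¹ + 3 * B := by
  have h1 := h.sym_mul_le g' (g'⁻¹ * g)
  rw [mul_inv_cancel_left] at h1
  linarith [h.ker_le (g'⁻¹ * g) (by rw [map_mul, map_inv, hg, inv_mul_cancel])]

/-- The symmetrization of `P`, as a pseudo-distance on `Γ`. -/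
noncomputable def symDist (P : E → ℝ) (lift : Γ → E) (u v : Γ) : ℝ :=
  P ((lift u)⁻¹ * lift v) + P ((lift u)⁻¹ * lift v)⁻¹

theorem symDist_le (h : IsCoarseWeight π t P B c) {lift : Γ → E} (hl : ∀ u, π (lift u) = u)
    {x y g : E} (hg : π g = (π x)⁻¹ * π y) :
    symDist P lift (π x) (π y) ≤ P g + P g⁻¹ + 3 * B ∧
      P g + P g⁻¹ ≤ symDist P lift (π x) (π y) + 3 * B :=
  ⟨h.sym_le_of_map_eq (by simp [hl, hg]), h.sym_le_of_map_eq (by simp [hl, hg])⟩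

theorem isCoarseDist (h : IsCoarseWeight π t P B c) {lift : Γ → E} (hl : ∀ u, π (lift u) = u) :
    IsCoarseDist (cayleyAdj fun i => π (t i)) (symDist P lift) (10 * B) (6 * B + 1) where
  self u := by
    simp only [symDist, inv_mul_cancel]
    linarith [h.ker_le 1 (map_one π), h.nonneg]
  lip x u v := by
    rintro ⟨i, rfl⟩
    have hB := h.nonneg
    have h1 := h.letter_le i
    have h2 := h.sym_mul_le ((lift x)⁻¹ * lift u) (t i)
    have h3 := h.sym_mul_le ((lift x)⁻¹ * lift u * t i) (t i)⁻¹
    rw [mul_inv_cancel_right, inv_inv] at h3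
    have h4 := h.sym_le_of_map_eq (g := (lift x)⁻¹ * lift (u * π (t i)))
      (g' := (lift x)⁻¹ * lift u * t i) (by simp [hl, mul_assoc])
    have h5 := h.sym_le_of_map_eq (g' := (lift x)⁻¹ * lift (u * π (t i)))
      (g := (lift x)⁻¹ * lift u * t i) (by simp [hl, mul_assoc])
    simp only [symDist]
    rw [abs_le]
    constructor <;> linarith

/-- The prefixes of a near-minimizing word form the path. Linear growth on subwords is the lower
tameness bound. For monotonicity, P(u⁻¹) ≤ P(v) + P((uv)⁻¹) + B, and P of u, v, uv is c times the
length up to B. Points near the path inherit the splitting of P at a prefix by subadditivity. -/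
theorem exists_side (h : IsCoarseWeight π t P B c) {lift : Γ → E} (hl : ∀ u, π (lift u) = u)
    (hsymm : ∀ u v : Γ, cayleyAdj (fun i => π (t i)) u v → cayleyAdj (fun i => π (t i)) v u)
    (x y : E) : ∃ (p : ℕ → Γ) (n : ℕ),
      IsTame (cayleyAdj fun i => π (t i)) (symDist P lift) (10 * B) p n ∧ p 0 = π x ∧ p n = π y ∧
      ∀ i ≤ n, ∀ (q : E) (k : ℕ), IsPath (cayleyAdj fun i => π (t i)) (p i) (π q) k →
        P (x⁻¹ * q) + P (q⁻¹ * y) ≤ P (x⁻¹ * y) + 16 * B + k * (6 * B + 1) := by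
  obtain ⟨w, hw, hexc, hsub⟩ := h.exists_word (x⁻¹ * y)
  have hB := h.nonneg
  have hdist := h.isCoarseDist hl
  have hsplit : ∀ i j, i ≤ j → j ≤ w.length → ∃ v v', w = w.take i ++ v ++ v' ∧
      v.length = j - i ∧ w.take j = w.take i ++ v := by
    intro i j hij hj
    refine ⟨(w.take j).drop i, w.drop j, ?_, by simp [hj], ?_⟩
    · conv_lhs => rw [← List.take_append_drop j w, ← List.take_append_drop i (w.take j)]
      rw [List.take_take, min_eq_left hij]
    · conv_lhs => rw [← List.take_append_drop i (w.take j)]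
      rw [List.take_take, min_eq_left hij]
  set p : ℕ → E := fun i => x * wordProd t (w.take i) with hp
  have hs : ∀ i j v, w.take j = w.take i ++ v →
      symDist P lift (π (p i)) (π (p j)) ≤ P (wordProd t v) + P (wordProd t v)⁻¹ + 3 * B ∧
      P (wordProd t v) + P (wordProd t v)⁻¹ ≤ symDist P lift (π (p i)) (π (p j)) + 3 * B := by
    intro i j v hv
    refine h.symDist_le hl ?_
    simp only [hp, hv, wordProd_append, map_mul]
    group
  have key : ∀ i j k, i ≤ j → j ≤ k → k ≤ w.length →
      symDist P lift (π (p i)) (π (p j)) ≤ symDist P lift (π (p i)) (π (p k)) + 10 * B := by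
    intro i j k hij hjk hk
    obtain ⟨u, u', hu, hul, huj⟩ := hsplit i j hij (hjk.trans hk)
    obtain ⟨v, v', hv, hvl, hvk⟩ := hsplit j k hjk hk
    have huv : w.take k = w.take i ++ (u ++ v) := by rw [hvk, huj, List.append_assoc]
    have hwuv : w = w.take i ++ (u ++ v) ++ v' := by rw [← huv, hvk]; exact hv
    have e1 := abs_le.1 (hsub _ _ _ hu).1
    have e2 := abs_le.1 (hsub _ _ _ hv).1
    have e3 := abs_le.1 (hsub _ _ _ hwuv).1
    have f1 := hs i j u huj
    have f3 := hs i k _ huv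
    rw [List.length_append] at e3
    push_cast at e3
    have g1 := h.mul_le (wordProd t v) (wordProd t (u ++ v))⁻¹
    rw [wordProd_append, mul_inv_rev, mul_inv_cancel_left, ← mul_inv_rev, ← wordProd_append] at g1
    linarith
  refine ⟨fun i => π (p i), w.length, ⟨?_, ?_, key⟩, ?_, ?_, ?_⟩
  · intro i hi
    refine ⟨w[i], ?_⟩
    simp only [hp, List.take_succ_eq_append_getElem hi, wordProd_append, wordProd_cons,
      wordProd_nil, mul_one, map_mul, mul_assoc]
  · intro i j hij hj
    obtain ⟨v, v', hv, hvl, hvj⟩ := hsplit i j hij hj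
    have h1 := (hsub _ _ _ hv).2
    have h2 := (hs i j v hvj).2
    rw [hvl, Nat.cast_sub hij] at h1
    linarith
  · simp [hp]
  · simp [hp, hw]
  · intro i hi q k hk
    have h1 := hexc (w.take i) (w.drop i) (List.take_append_drop i w).symm
    have h2 := (abs_le.1 ((hk.symm hsymm).lipschitz (hdist.lip (π (p i))))).2
    have h3 := hdist.self (π (p i))
    have h4 := (h.symDist_le hl (x := p i) (y := q) (g := (p i)⁻¹ * q) (by simp)).2
    have h5 := h.mul_le (wordProd t (w.take i)) ((p i)⁻¹ * q)
    have h6 := h.mul_le ((p i)⁻¹ * q)⁻¹ ((wordProd t (w.take i))⁻¹ * (x⁻¹ * y))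
    have e1 : wordProd t (w.take i) * ((p i)⁻¹ * q) = x⁻¹ * q := by simp [hp, mul_assoc]
    have e2 : ((p i)⁻¹ * q)⁻¹ * ((wordProd t (w.take i))⁻¹ * (x⁻¹ * y)) = q⁻¹ * y := by
      simp [hp, mul_assoc]
    rw [e1] at h5
    rw [e2] at h6
    linarith

end IsCoarseWeight

end CoarseWeights

theorem HasLinearIntegrals.nonneg {V : Type*} [Nonempty V] {adj : V → V → Prop} {C : ℝ}
    (hL : HasLinearIntegrals adj C) : 0 ≤ C := by
  obtain ⟨u⟩ := ‹Nonempty V›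
  simpa using hL.integral 0 0 (by simp) (by simp) u 0 0 (.nil u)

/-! ### Centres of triangles and the extension criterion. -/

section ExtensionCriterion

variable {E Γ ι : Type*} [Group E] [Group Γ] {π : E →* Γ} {t : ι → E} {P : E → ℝ} {B c C : ℝ}

/-- A connectedness argument on a thin triangle finds a point near all three sides. As P is not
symmetric, the sides from x to y and from y to x are different paths; thinness of the bigon they
form makes one point serve both directions. -/
theorem IsCoarseWeight.exists_center (h : IsCoarseWeight π t P B c)
    (hπ : Function.Surjective π) (hL : HasLinearIntegrals (cayleyAdj fun i => π (t i)) C) :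
    ∃ R : ℝ, ∀ x y z : E, ∃ p : E,
      P (x⁻¹ * p) + P (p⁻¹ * y) ≤ P (x⁻¹ * y) + R ∧ P (y⁻¹ * p) + P (p⁻¹ * x) ≤ P (y⁻¹ * x) + R ∧
      P (x⁻¹ * p) + P (p⁻¹ * z) ≤ P (x⁻¹ * z) + R ∧ P (z⁻¹ * p) + P (p⁻¹ * x) ≤ P (z⁻¹ * x) + R ∧
      P (y⁻¹ * p) + P (p⁻¹ * z) ≤ P (y⁻¹ * z) + R ∧
      P (z⁻¹ * p) + P (p⁻¹ * y) ≤ P (z⁻¹ * y) + R := by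
  choose lift hl using hπ
  have hB := h.nonneg
  have hdist := h.isCoarseDist hl
  obtain ⟨N, hN⟩ := hL.exists_thin (by linarith) (by linarith) hL.nonneg hdist
  set adj := cayleyAdj fun i => π (t i) with hadj
  have near : ∀ x y : E, ∀ (q : E) (k : ℕ) (p : ℕ → Γ) (n : ℕ),
      IsTame adj (symDist P lift) (10 * B) p n → p 0 = π x → p n = π y →
      (∃ i ≤ n, IsPath adj (π q) (p i) k) →
      P (x⁻¹ * q) + P (q⁻¹ * y) ≤ P (x⁻¹ * y) + 16 * B + ((k + N : ℕ) : ℝ) * (6 * B + 1) ∧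
      P (y⁻¹ * q) + P (q⁻¹ * x) ≤ P (y⁻¹ * x) + 16 * B + ((k + N : ℕ) : ℝ) * (6 * B + 1) := by
    rintro x y q k p n hp hp0 hpn ⟨i, hi, hk⟩
    have aux : ∀ (p' : ℕ → Γ) (n' : ℕ), IsTame adj (symDist P lift) (10 * B) p' n' →
        (p' 0 = p 0 ∧ p' n' = p n ∨ p' 0 = p n ∧ p' n' = p 0) → ∃ j ≤ n', ∃ m ≤ k + N,
          IsPath adj (p' j) (π q) m := by
      intro p' n' hp' hends
      -- A bigon is a triangle whose third side is constant of length 0.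
      obtain ⟨u, hu, m, hm, hpm⟩ := hN p p' (fun _ => p' n') n n' 0 hp hp'
        ⟨by simp, fun a b hab hb => by
            obtain rfl : b = 0 := by lia
            obtain rfl : a = 0 := by lia
            have h1 := (h.symDist_le hl (x := lift (p' n')) (y := lift (p' n')) (g := 1)
              (by simp)).2
            have h2 := h.one_ge
            rw [hl, inv_one] at h1
            push_cast
            linarith,
          fun a b c _ _ _ => by linarith⟩ rfl _ rfl
        (by
          rcases hends with ⟨h1, h2⟩ | ⟨h1, h2⟩
          · exact Or.inl ⟨0, by lia, h1.symm⟩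
          · exact Or.inl ⟨n', le_rfl, h2.symm⟩)
        (by
          rcases hends with ⟨h1, h2⟩ | ⟨h1, h2⟩
          · exact Or.inl ⟨n', le_rfl, h2.symm⟩
          · exact Or.inl ⟨0, by lia, h1.symm⟩) i hi
      have hu' : ∃ j ≤ n', u = p' j := by
        rcases hu with hu | ⟨_, _, hu⟩
        · exact hu
        · exact ⟨n', le_rfl, hu⟩
      obtain ⟨j, hj, rfl⟩ := hu'
      exact ⟨j, hj, k + m, by lia, (hk.trans hpm).symm hL.symm⟩
    have fin : ∀ m ≤ k + N, (m : ℝ) * (6 * B + 1) ≤ ((k + N : ℕ) : ℝ) * (6 * B + 1) :=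
      fun m hm => mul_le_mul_of_nonneg_right (by exact_mod_cast hm) (by linarith)
    constructor
    · obtain ⟨p', n', hp', h0, h1, hex⟩ := h.exists_side hl hL.symm x y
      obtain ⟨j, hj, m, hm, hpm⟩ := aux p' n' hp' (Or.inl ⟨by rw [h0, hp0], by rw [h1, hpn]⟩)
      linarith [hex j hj q m hpm, fin m hm]
    · obtain ⟨p', n', hp', h0, h1, hex⟩ := h.exists_side hl hL.symm y x
      obtain ⟨j, hj, m, hm, hpm⟩ := aux p' n' hp' (Or.inr ⟨by rw [h0, hpn], by rw [h1, hp0]⟩)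
      linarith [hex j hj q m hpm, fin m hm]
  refine ⟨16 * B + ((N + 1 + N : ℕ) : ℝ) * (6 * B + 1), fun x y z => ?_⟩
  obtain ⟨α, n, hα, hα0, hαn, -⟩ := h.exists_side hl hL.symm x y
  obtain ⟨β, m, hβ, hβ0, hβm, -⟩ := h.exists_side hl hL.symm x z
  obtain ⟨γ, l, hγ, hγ0, hγl, -⟩ := h.exists_side hl hL.symm y z
  have thin := hN α β γ n m l hα hβ hγ (hβm.trans hγl.symm) _ rfl
    (Or.inl ⟨0, by lia, by rw [hα0, hβ0]⟩) (Or.inr ⟨0, by lia, by rw [hαn, hγ0]⟩)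
  have hcenter : ∃ i ≤ n, (∃ j ≤ m, ∃ k ≤ N + 1, IsPath adj (α i) (β j) k) ∧
      ∃ j ≤ l, ∃ k ≤ N + 1, IsPath adj (α i) (γ j) k := by
    -- Without a point near both, consecutive points of α could not switch from β to γ, so all of α
    -- would stay near β. But its last point lies on γ.
    by_contra! hno
    have : ∀ i ≤ n, ∃ j ≤ m, ∃ k ≤ N, IsPath adj (α i) (β j) k := by
      intro i
      induction i with
      | zero => exact fun _ => ⟨0, by lia, 0, by lia, by rw [hα0, hβ0]; exact .nil _⟩
      | succ i ih =>
        intro hi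
        obtain ⟨j, hj, k, hk, hp⟩ := ih (by lia)
        obtain ⟨u, ⟨j', hj', rfl⟩ | ⟨j', hj', rfl⟩, k', hk', hp'⟩ := thin (i + 1) hi
        · exact ⟨j', hj', k', hk', hp'⟩
        · exact absurd (hp'.cons (hα.step i (by lia)))
            (hno i (by lia) ⟨j, hj, k, by lia, hp⟩ j' hj' (k' + 1) (by lia))
    obtain ⟨j, hj, k, hk, hp⟩ := this n le_rfl
    exact hno n le_rfl ⟨j, hj, k, by lia, hp⟩ 0 (by lia) 0 (by lia)
      (by rw [hαn, hγ0]; exact .nil _)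
  obtain ⟨i, hi, ⟨j, hj, k, hk, hp⟩, j', hj', k', hk', hp'⟩ := hcenter
  have fin : ∀ m ≤ N + 1, ((m + N : ℕ) : ℝ) * (6 * B + 1) ≤
      ((N + 1 + N : ℕ) : ℝ) * (6 * B + 1) := fun m hm =>
    mul_le_mul_of_nonneg_right (by exact_mod_cast (by lia : m + N ≤ N + 1 + N)) (by linarith)
  have e1 := near x y (lift (α i)) 0 α n hα hα0 hαn ⟨i, hi, by rw [hl]; exact .nil _⟩
  have e2 := near x z (lift (α i)) k β m hβ hβ0 hβm ⟨j, hj, by rwa [hl]⟩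
  have e3 := near y z (lift (α i)) k' γ l hγ hγ0 hγl ⟨j', hj', by rwa [hl]⟩
  have f1 := fin 0 (by lia)
  have f2 := fin k hk
  have f3 := fin k' hk'
  refine ⟨lift (α i), ?_, ?_, ?_, ?_, ?_, ?_⟩ <;> linarith [e1.1, e1.2, e2.1, e2.2, e3.1, e3.2]

/-- If the quotient has linear integrals and `φ` is linearly bounded on words representing kernel
elements, then `φ` extends from the kernel up to a bounded error. -/
theorem IsLinearOnKernel.exists_extension {φ : E → ℝ} {D C' : ℝ}
    (h : IsLinearOnKernel π φ t D C') (hL : HasLinearIntegrals (cayleyAdj fun i => π (t i)) C) :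
    ∃ (Φ : E → ℝ) (R : ℝ), (∀ g k, |Φ (g * k) - Φ g - Φ k| ≤ R) ∧
      (∀ k, π k = 1 → |Φ k - φ k| ≤ R) ∧ ∀ i, |Φ (t i)| ≤ R := by
  have hC' : 0 ≤ C' := by
    have := h.linear [] (by simp)
    rw [List.length_nil, Nat.cast_zero, zero_add, mul_one] at this
    exact (abs_nonneg _).trans this
  have hD := h.nonneg
  have hw := h.isCoarseWeight hC'
  have hπ : Function.Surjective π := fun γ => by
    obtain ⟨w, hw⟩ := h.surj γ
    exact ⟨_, hw⟩
  obtain ⟨R, hR⟩ := hw.exists_center hπ hL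
  have hone := hw.one_ge
  have hletter := h.wordMin_letter_le
  have hletter' := h.wordMin_letter_inv_le
  have hker : ∀ k, π k = 1 → |wordMin π φ t (C' + 1) k - φ k| ≤ C' + 3 * D + 1 :=
    fun k hk => h.abs_wordMin_sub_le hk
  set P := wordMin π φ t (C' + 1)
  set B := 10 * C' + 20 * D + 20 with hB
  refine ⟨fun g => (P g - P g⁻¹) / 2, 3 * |R| + 3 * B, fun g k => ?_, fun k hk => ?_,
    fun i => ?_⟩
  -- The six increments of the triangle 1, g, gk are g, k, gk and their inverses.
  · obtain ⟨p, h1, h2, h3, h4, h5, h6⟩ := hR 1 g (g * k)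
    have tri : ∀ x y : E, P (x⁻¹ * y) ≤ P (x⁻¹ * p) + P (p⁻¹ * y) + B := fun x y => by
      have := hw.mul_le (x⁻¹ * p) (p⁻¹ * y)
      rwa [mul_assoc, mul_inv_cancel_left] at this
    have t1 := tri 1 g
    have t2 := tri g 1
    have t3 := tri 1 (g * k)
    have t4 := tri (g * k) 1
    have t5 := tri g (g * k)
    have t6 := tri (g * k) g
    have e : (g * k)⁻¹ * g = k⁻¹ := by group
    simp only [inv_mul_cancel_left, e] at *
    simp only [inv_one, one_mul, mul_one] at *
    have := le_abs_self R
    rw [abs_le]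
    constructor <;> linarith
  · have h1 := abs_le.1 (hker k hk)
    have h2 := abs_le.1 (hker k⁻¹ (by rw [map_inv, hk, inv_one]))
    have h3 := abs_le.1 (h.abs_inv hk)
    have := abs_nonneg R
    rw [abs_le]
    constructor <;> linarith
  · have h1 := hletter i
    have h2 := hletter' i
    have h3 := hw.mul_le (t i) (t i)⁻¹
    rw [mul_inv_cancel] at h3
    have := abs_nonneg R
    rw [abs_le]
    constructor <;> linarith

end ExtensionCriterion

/-! ### Linear integrals from a linear relative isoperimetric inequality. -/

section RelFreeIntegrals

/-- The integral of `f dg` along a path differs from its one-step value by a bounded amount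
depending only on the length. -/
theorem PathIntegral.abs_sub_le {V : Type*} {adj : V → V → Prop} {f g : V → ℝ}
    (hf : ∀ u v, adj u v → |f u - f v| ≤ 1) (hg : ∀ u v, adj u v → |g u - g v| ≤ 1)
    {u v : V} {n : ℕ} {J : ℝ} (h : PathIntegral adj f g u v n J) :
    |g u - g v| ≤ n ∧ |J - f u * (g v - g u)| ≤ n * n := by
  induction h with
  | nil => simp
  | @cons u w v n J huw _ ih =>
    have h1 : |(f w - f u) * (g v - g w)| ≤ 1 * n := by
      rw [abs_mul, abs_sub_comm (f w), abs_sub_comm (g v)]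
      exact mul_le_mul (hf u w huw) ih.1 (abs_nonneg _) zero_le_one
    have h2 := _root_.abs_sub_le (g u) (g w) (g v)
    push_cast
    refine ⟨by linarith [hg u w huw, ih.1], ?_⟩
    have h3 : f u * (g w - g u) + J - f u * (g v - g u) =
        (J - f w * (g v - g w)) + (f w - f u) * (g v - g w) := by ring
    rw [h3]
    have := abs_add_le (J - f w * (g v - g w)) ((f w - f u) * (g v - g w))
    have hn : (0:ℝ) ≤ n := n.cast_nonneg
    linarith [ih.2]

theorem relWordProd_nil {G : Type*} [Group G] (K : Subgroup G) (X : Set G) :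
    relWordProd K X [] = 1 := rfl

theorem relWordProd_cons {G : Type*} [Group G] (K : Subgroup G) (X : Set G)
    (i : K ⊕ (X × Bool)) (w : List (K ⊕ (X × Bool))) :
    relWordProd K X (i :: w) = relLetter K X i * relWordProd K X w := by
  simp [relWordProd]

theorem relLength_relWordProd_le {G : Type*} [Group G] (K : Subgroup G) (X : Set G)
    (w : List (K ⊕ (X × Bool))) : relLength K X (relWordProd K X w) ≤ w.length :=
  Nat.sInf_le ⟨w, rfl, rfl⟩

variable {Γ₀ Γ : Type*} [Group Γ₀] [Group Γ] {Q : Subgroup Γ₀} {X : Set Γ₀}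

theorem exists_relLetter_inv (i : Q ⊕ (X × Bool)) :
    ∃ j, relLetter Q X i * relLetter Q X j = 1 := by
  rcases i with h | ⟨x, _ | _⟩
  · exact ⟨Sum.inl h⁻¹, by simp [relLetter]⟩
  · exact ⟨Sum.inr (x, true), by simp [relLetter]⟩
  · exact ⟨Sum.inr (x, false), by simp [relLetter]⟩

/-- The shear of `Γ × ℝ` over the right translation by `x`. -/
def shear (ψ : Γ → ℝ) (x : Γ) : Equiv.Perm (Γ × ℝ) where
  toFun p := (p.1 * x, p.2 + ψ p.1)
  invFun p := (p.1 * x⁻¹, p.2 - ψ (p.1 * x⁻¹))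
  left_inv p := by simp
  right_inv p := by simp

/-- There is a real cocycle on `Q * F(X)` that agrees with `f dg` on the letters, up to an error of
at most `1`. -/
theorem exists_cocycle (ρ : RelFree Q X →* Γ) {f g : Γ → ℝ}
    (hf : ∀ u v, cayleyAdj (fun i => ρ (relLetter Q X i)) u v → |f u - f v| ≤ 1)
    (hg : ∀ u v, cayleyAdj (fun i => ρ (relLetter Q X i)) u v → |g u - g v| ≤ 1) :
    ∃ ω : RelFree Q X → Γ → ℝ, (∀ a b v, ω (a * b) v = ω a v + ω b (v * ρ a)) ∧
      ∀ i v, |f v * (g (v * ρ (relLetter Q X i)) - g v) - ω (relLetter Q X i) v| ≤ 1 := by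
  classical
  let S : Subgroup Γ := (ρ.comp Monoid.Coprod.inl).range
  -- Letters from Q satisfy relations, so f dg must be replaced there by an exact coboundary.
  -- Joining v to a fixed point `cone v` of its coset gives the potential u(v) = f(v)(g(cone v) -
  -- g(v)). The error on a letter h is a product of an increment of f and one of g along edges,
  -- hence at most 1.
  let cone : Γ → Γ := fun v => (v : Γ ⧸ S).out
  have cone_mul : ∀ v (h : Q), cone (v * ρ (.inl h)) = cone v := fun v h => by
    simp only [cone]
    congr 1
    exact QuotientGroup.eq.2 ⟨h⁻¹, by simp⟩
  have cone_adj : ∀ v, cayleyAdj (fun i => ρ (relLetter Q X i)) v (cone v) := fun v => by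
    obtain ⟨⟨_, h, rfl⟩, hs⟩ := QuotientGroup.mk_out_eq_mul S v
    exact ⟨Sum.inl h, hs⟩
  let u : Γ → ℝ := fun v => f v * (g (cone v) - g v)
  -- The cocycle is read off an action on Γ × ℝ, so the universal property of the free product
  -- constructs it. The opposite group appears because right translations compose in reverse.
  let A : Q →* (Equiv.Perm (Γ × ℝ))ᵐᵒᵖ :=
    { toFun := fun h => .op (shear (fun v => u v - u (v * ρ (.inl h))) (ρ (.inl h)))
      map_one' := by
        apply MulOpposite.unop_injective
        ext p <;> simp [shear]
      map_mul' := fun h h' => by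
        apply MulOpposite.unop_injective
        ext p
        · simp [shear, mul_assoc]
        · simp only [shear, map_mul, MulOpposite.unop_op, Equiv.coe_fn_mk, MulOpposite.unop_mul,
            Equiv.Perm.coe_mul, Function.comp_apply, mul_assoc]
          ring }
  let F : FreeGroup X →* (Equiv.Perm (Γ × ℝ))ᵐᵒᵖ := FreeGroup.lift fun x =>
    .op (shear (fun v => f v * (g (v * ρ (.inr (.of x))) - g v)) (ρ (.inr (.of x))))
  let Ψ : RelFree Q X →* (Equiv.Perm (Γ × ℝ))ᵐᵒᵖ := Monoid.Coprod.lift A F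
  let T : RelFree Q X → Equiv.Perm (Γ × ℝ) := fun a => (Ψ a).unop
  have T_mul : ∀ a b p, T (a * b) p = T b (T a p) := fun a b p => by simp [T]
  have T_inl : ∀ h, T (.inl h) = shear (fun v => u v - u (v * ρ (.inl h))) (ρ (.inl h)) := fun h => by
    simp [T, Ψ, A]
  have T_inr : ∀ x, T (.inr (.of x)) =
      shear (fun v => f v * (g (v * ρ (.inr (.of x))) - g v)) (ρ (.inr (.of x))) := fun x => by
    simp [T, Ψ, F]
  have T_inr_inv : ∀ x, T (.inr (.of x)⁻¹) = (T (.inr (.of x)))⁻¹ := fun x => by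
    simp [T, Ψ, F]
  have T_letter : ∀ i, ∃ ψ, T (relLetter Q X i) = shear ψ (ρ (relLetter Q X i)) := by
    rintro (h | ⟨x, _ | _⟩)
    · exact ⟨_, T_inl h⟩
    · refine ⟨fun v => -(f (v * (ρ (.inr (.of x)))⁻¹) * (g v - g (v * (ρ (.inr (.of x)))⁻¹))), ?_⟩
      rw [relLetter, T_inr_inv, T_inr]
      ext p <;> simp [shear, Equiv.Perm.inv_def, sub_eq_add_neg]
    · exact ⟨_, T_inr x⟩
  have T_apply : ∀ a v r, T a (v, r) = (v * ρ a, r + (T a (v, 0)).2) := by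
    intro a
    obtain ⟨w, rfl⟩ := relWordProd_surjective Q X a
    induction w with
    | nil => simp [relWordProd_nil, T]
    | cons i w ih =>
      intro v r
      obtain ⟨ψ, hψ⟩ := T_letter i
      rw [relWordProd_cons, T_mul, T_mul, hψ]
      simp only [shear, Equiv.coe_fn_mk]
      rw [ih, ih _ (0 + ψ v)]
      simp [mul_assoc, add_assoc]
  refine ⟨fun a v => (T a (v, 0)).2, fun a b v => ?_, ?_⟩
  · change (T (a * b) (v, 0)).2 = (T a (v, 0)).2 + (T b (v * ρ a, 0)).2
    rw [T_mul, T_apply a, T_apply b]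
  · have small : ∀ {x y : ℝ}, |x| ≤ 1 → |y| ≤ 1 → |x * y| ≤ 1 := fun hx hy => by
      rw [abs_mul]
      exact mul_le_one₀ hx (abs_nonneg _) hy
    have hadj : ∀ i v, cayleyAdj (fun i => ρ (relLetter Q X i)) v (v * ρ (relLetter Q X i)) :=
      fun i v => ⟨i, rfl⟩
    rintro (h | ⟨x, _ | _⟩) v
    · have h1 := hf _ _ (hadj (Sum.inl h) v)
      have h2 := hg _ _ (cone_adj (v * ρ (.inl h)))
      simp only [relLetter] at h1 ⊢
      rw [T_inl]
      simp only [shear, Equiv.coe_fn_mk, u, cone_mul] at h2 ⊢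
      convert small h1 h2 using 2
      ring
    · have h1 := hf _ _ (hadj (Sum.inr (x, false)) v)
      have h2 := hg _ _ (hadj (Sum.inr (x, false)) v)
      rw [abs_sub_comm] at h2
      simp only [relLetter, map_inv] at h1 h2 ⊢
      rw [← map_inv (Monoid.Coprod.inr : FreeGroup X →* RelFree Q X), T_inr_inv, T_inr]
      simp only [shear, Equiv.Perm.inv_def, Equiv.coe_fn_symm_mk]
      convert small h1 h2 using 2
      simp
      ring
    · simp only [relLetter]
      rw [T_inr]
      simp [shear]

theorem PathIntegral.exists_relWord (ρ : RelFree Q X →* Γ) {f g : Γ → ℝ}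
    {ω : RelFree Q X → Γ → ℝ} (hω : ∀ a b v, ω (a * b) v = ω a v + ω b (v * ρ a))
    (hω' : ∀ i v, |f v * (g (v * ρ (relLetter Q X i)) - g v) - ω (relLetter Q X i) v| ≤ 1)
    {u v : Γ} {n : ℕ} {J : ℝ}
    (h : PathIntegral (cayleyAdj fun i => ρ (relLetter Q X i)) f g u v n J) :
    ∃ w : List (Q ⊕ (X × Bool)), w.length = n ∧ v = u * ρ (relWordProd Q X w) ∧
      |J - ω (relWordProd Q X w) u| ≤ n := by
  induction h with
  | nil u =>
    have := hω 1 1 u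
    refine ⟨[], rfl, by simp [relWordProd_nil], ?_⟩
    simp only [mul_one, map_one, relWordProd_nil] at *
    simp [show ω 1 u = 0 by linarith]
  | @cons u x v n J hux _ ih =>
    obtain ⟨i, rfl⟩ := hux
    obtain ⟨w, rfl, hv, hle⟩ := ih
    refine ⟨i :: w, rfl, by rw [hv, relWordProd_cons, map_mul, mul_assoc], ?_⟩
    have := abs_le.1 (hω' i u)
    have := abs_le.1 hle
    rw [relWordProd_cons, hω]
    push_cast
    rw [abs_le]
    constructor <;> linarith

theorem exists_pathIntegral_relWord (ρ : RelFree Q X →* Γ) {f g : Γ → ℝ}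
    {ω : RelFree Q X → Γ → ℝ} (hω : ∀ a b v, ω (a * b) v = ω a v + ω b (v * ρ a))
    (hω' : ∀ i v, |f v * (g (v * ρ (relLetter Q X i)) - g v) - ω (relLetter Q X i) v| ≤ 1)
    (w : List (Q ⊕ (X × Bool))) (u : Γ) :
    ∃ J, PathIntegral (cayleyAdj fun i => ρ (relLetter Q X i)) f g u
      (u * ρ (relWordProd Q X w)) w.length J ∧ |J - ω (relWordProd Q X w) u| ≤ w.length := by
  induction w generalizing u with
  | nil =>
    have := hω 1 1 u
    refine ⟨0, by simpa [relWordProd_nil] using PathIntegral.nil u, ?_⟩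
    simp only [mul_one, map_one, relWordProd_nil] at *
    simp [show ω 1 u = 0 by linarith]
  | cons i w ih =>
    obtain ⟨J, hJ, hle⟩ := ih (u * ρ (relLetter Q X i))
    rw [relWordProd_cons, map_mul, ← mul_assoc]
    refine ⟨_, hJ.cons ⟨i, rfl⟩, ?_⟩
    have := abs_le.1 (hω' i u)
    have := abs_le.1 hle
    rw [hω, List.length_cons]
    push_cast
    rw [abs_le]
    constructor <;> linarith

/-- Linear integrals in a quotient of `Q * F(X)` in which every element of the kernel of length `n`
is a product of linearly many conjugates of finitely many relators. -/
theorem hasLinearIntegrals_of_isoperimetric (ρ : RelFree Q X →* Γ)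
    (hρ : Function.Surjective ρ) {R : Set (RelFree Q X)} (hR : R.Finite)
    (hRρ : ∀ r ∈ R, ρ r = 1) {C : ℝ}
    (hC : ∀ w : List (Q ⊕ (X × Bool)), ρ (relWordProd Q X w) = 1 →
      ∃ l : List (RelFree Q X × RelFree Q X), (l.length : ℝ) ≤ C * w.length + C ∧
        (∀ p ∈ l, p.2 ∈ R ∨ p.2⁻¹ ∈ R) ∧
        relWordProd Q X w = (l.map (fun p => p.1 * p.2 * p.1⁻¹)).prod) :
    ∃ C', HasLinearIntegrals (cayleyAdj fun i => ρ (relLetter Q X i)) C' := by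
  have hC0 : 0 ≤ C := by
    obtain ⟨l, hl, -⟩ := hC [] (by simp [relWordProd_nil])
    have : (0:ℝ) ≤ l.length := Nat.cast_nonneg _
    simp only [List.length_nil, Nat.cast_zero, mul_zero, zero_add] at hl
    linarith
  choose W hW using relWordProd_surjective Q X
  obtain ⟨N, hN⟩ := (hR.image fun r => (W r).length).bddAbove
  have hN' : ∀ r ∈ R, (W r).length ≤ N := fun r hr => hN ⟨r, hr, rfl⟩
  -- The 1 is the cocycle error per letter of the loop. Each relator is a loop of length at most N,
  -- with integral at most N² and cocycle error at most N; conjugation only moves its basepoint.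
  refine ⟨1 + C * (N + N * N), ?_, ?_, ?_⟩
  · rintro u _ ⟨i, rfl⟩
    obtain ⟨j, hj⟩ := exists_relLetter_inv i
    exact ⟨j, by rw [mul_assoc, ← map_mul, hj, map_one, mul_one]⟩
  · intro u v
    have path : ∀ (w : List (Q ⊕ (X × Bool))) (u : Γ),
        IsPath (cayleyAdj fun i => ρ (relLetter Q X i)) u (u * ρ (relWordProd Q X w)) w.length := by
      intro w
      induction w with
      | nil => intro u; simpa [relWordProd_nil] using IsPath.nil u
      | cons i w ih =>
        intro u
        have := (ih (u * ρ (relLetter Q X i))).cons ⟨i, rfl⟩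
        rwa [mul_assoc, ← map_mul, ← relWordProd_cons] at this
    obtain ⟨a, ha⟩ := hρ (u⁻¹ * v)
    exact ⟨_, by simpa [hW, ha] using path (W a) u⟩
  · intro f g hf hg u n J hJ
    obtain ⟨ω, hω, hω'⟩ := exists_cocycle ρ hf hg
    obtain ⟨w, rfl, hv, hle⟩ := hJ.exists_relWord ρ hω hω'
    have hw : ρ (relWordProd Q X w) = 1 := by simpa using hv
    obtain ⟨l, hl, hlR, hprod⟩ := hC w hw
    have ω_one : ∀ v, ω 1 v = 0 := fun v => by
      have := hω 1 1 v
      simp only [mul_one, map_one] at this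
      linarith
    have ω_rel : ∀ r ∈ R, ∀ v, |ω r v| ≤ N + N * N := by
      intro r hr v
      obtain ⟨J', hJ', hle'⟩ := exists_pathIntegral_relWord ρ hω hω' (W r) v
      rw [hW, hRρ r hr, mul_one] at hJ'
      have h1 := abs_le.1 (hJ'.abs_sub_le hf hg).2
      rw [sub_self, mul_zero, sub_zero] at h1
      rw [hW] at hle'
      have h2 := abs_le.1 hle'
      have h3 : ((W r).length : ℝ) ≤ N := by exact_mod_cast hN' r hr
      have h4 := mul_le_mul h3 h3 (Nat.cast_nonneg _) (Nat.cast_nonneg _)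
      rw [abs_le]
      constructor <;> linarith
    have ω_rel' : ∀ p : RelFree Q X × RelFree Q X, (p.2 ∈ R ∨ p.2⁻¹ ∈ R) →
        ρ p.2 = 1 ∧ ∀ v, |ω (p.1 * p.2 * p.1⁻¹) v| ≤ N + N * N := by
      rintro ⟨p, r⟩ hr
      have hr1 : ρ r = 1 := by
        rcases hr with hr | hr
        · exact hRρ r hr
        · simpa using hRρ _ hr
      have hr2 : ∀ v, |ω r v| ≤ N + N * N := by
        rcases hr with hr | hr
        · exact ω_rel r hr
        · intro v
          have h1 := ω_rel _ hr v
          have h2 := hω r r⁻¹ v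
          rw [mul_inv_cancel, ω_one, hr1, mul_one] at h2
          rwa [show ω r v = -ω r⁻¹ v by linarith, abs_neg]
      refine ⟨hr1, fun v => ?_⟩
      have h1 := hω p p⁻¹ v
      rw [mul_inv_cancel, ω_one] at h1
      have h2 : ω (p * r * p⁻¹) v = ω r (v * ρ p) := by
        rw [hω, hω, map_mul, hr1, mul_one]
        linarith
      rw [h2]
      exact hr2 _
    have sum : ∀ l : List (RelFree Q X × RelFree Q X), (∀ p ∈ l, p.2 ∈ R ∨ p.2⁻¹ ∈ R) →
        ∀ v, |ω (l.map (fun p => p.1 * p.2 * p.1⁻¹)).prod v| ≤ l.length * (N + N * N) := by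
      intro l
      induction l with
      | nil => intro _ v; simp [ω_one]
      | cons p l ih =>
        intro hl v
        obtain ⟨h1, h2⟩ := ω_rel' p (hl p (by simp))
        have h3 := ih (fun q hq => hl q (by simp [hq])) v
        rw [List.map_cons, List.prod_cons, hω, map_mul, map_mul, h1, mul_one, map_inv,
          mul_inv_cancel, mul_one, List.length_cons]
        push_cast
        linarith [h2 v, abs_add_le (ω (p.1 * p.2 * p.1⁻¹) v)
          (ω (l.map (fun p => p.1 * p.2 * p.1⁻¹)).prod v)]
    have h1 := sum l hlR u
    rw [← hprod] at h1
    have h2 : (l.length : ℝ) * (N + N * N) ≤ (C * w.length + C) * (N + N * N) :=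
      mul_le_mul_of_nonneg_right hl (by positivity)
    have h3 := abs_add_le (J - ω (relWordProd Q X w) u) (ω (relWordProd Q X w) u)
    rw [sub_add_cancel] at h3
    linarith

theorem hasLinearIntegrals_relFree (Q : Subgroup Γ₀) (X : Set Γ₀) :
    ∃ C, HasLinearIntegrals (cayleyAdj (relLetter Q X)) C := by
  refine hasLinearIntegrals_of_isoperimetric (MonoidHom.id (RelFree Q X)) (fun a => ⟨a, rfl⟩)
    Set.finite_empty (by simp) (C := 0) fun w hw => ⟨[], by simp, by simp, ?_⟩
  simpa using hw

end RelFreeIntegrals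

/-! ### Normal forms in the free product give a linear bound on words. -/

section FreeProductSection

open Monoid

variable {G Γ : Type*} [Group G] [Group Γ] {π : G →* Γ} {φ : G → ℝ} {D D' : ℝ}

section CoprodI

variable {J : Type*} {M : J → Type*} [∀ j, Group (M j)]

/-- The product of the chosen lifts of the syllables of a reduced word. -/
def syllableProd (l : ∀ j, M j → G) (w : CoprodI.Word M) : G :=
  (w.toList.map fun x => l x.1 x.2).prod

variable [∀ j, DecidableEq (M j)]

theorem syllableProd_rcons {l : ∀ j, M j → G} (hl : ∀ j, l j 1 = 1) {j : J}
    (p : CoprodI.Word.Pair M j) :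
    syllableProd l (CoprodI.Word.rcons p) = l j p.head * syllableProd l p.tail := by
  by_cases h : p.head = 1
  · simp [CoprodI.Word.rcons, h, hl]
  · simp [CoprodI.Word.rcons, h, syllableProd, CoprodI.Word.cons]

/-- Left multiplication by an element of one factor alters only the first syllable of a normal form,
so the lift fails to be multiplicative by a single defect in that factor. -/
theorem exists_syllableProd_smul [DecidableEq J] {l : ∀ j, M j → G} (hl : ∀ j, l j 1 = 1) {j : J} (m : M j)
    (w : CoprodI.Word M) : ∃ b : M j, l j m * syllableProd l w *
      (syllableProd l (CoprodI.of m • w))⁻¹ = l j m * l j b * (l j (m * b))⁻¹ := by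
  refine ⟨(CoprodI.Word.equivPair j w).head, ?_⟩
  have hw : w = CoprodI.Word.rcons (CoprodI.Word.equivPair j w) :=
    ((CoprodI.Word.equivPair j).symm_apply_apply w).symm
  conv_lhs =>
    enter [1, 2]
    rw [hw]
  rw [CoprodI.Word.of_smul_def, syllableProd_rcons hl, syllableProd_rcons hl]
  simp [mul_assoc]

end CoprodI

/-- The two free factors of `Q * F(X)`. -/
def relFactor (Q : Subgroup Γ) (X : Set Γ) : Bool → Type _
  | true => Q
  | false => FreeGroup X

instance (Q : Subgroup Γ) (X : Set Γ) : ∀ b, Group (relFactor Q X b)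
  | true => inferInstanceAs (Group Q)
  | false => inferInstanceAs (Group (FreeGroup X))

/-- The letters of `Q * F(X)`, lifted along a choice of lifts of `Q` and of `X`. -/
def liftLetter {Q : Subgroup Γ} {X : Set Γ} (l : Q → G) (m : X → G) : Q ⊕ (X × Bool) → G
  | Sum.inl h => l h
  | Sum.inr (x, true) => m x
  | Sum.inr (x, false) => (m x)⁻¹

theorem map_liftLetter {Q : Subgroup Γ} {X : Set Γ} {l : Q → G} {m : X → G}
    (hl : ∀ h, π (l h) = h) (hm : ∀ x, π (m x) = x) (i : Q ⊕ (X × Bool)) :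
    π (liftLetter l m i) = relTheta Q X (relLetter Q X i) := by
  rcases i with h | ⟨x, _ | _⟩ <;> simp [liftLetter, relLetter, relTheta, hl, hm]

/-- Lifting normal forms syllable by syllable defines a section σ over Q * F(X). Reading a word
letter by letter, its product drifts from σ by one conjugation and one defect per letter, hence
linearly; a word trivial in Q * F(X) has σ = 1. -/
theorem IsKernelQuasimorphism.abs_wordProd_le_of_relWordProd_eq_one
    (h : IsKernelQuasimorphism π φ D) {Q : Subgroup Γ} {X : Set Γ} {l : Q → G} {m : X → G}
    (hl : ∀ h, π (l h) = h) (hl1 : l 1 = 1)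
    (hdef : ∀ a b, |φ (l a * l b * (l (a * b))⁻¹)| ≤ D')
    {w : List (Q ⊕ (X × Bool))} (hw : relWordProd Q X w = 1) :
    |φ (wordProd (liftLetter l m) w)| ≤ (D + D' + 2 * D) * (w.length + 1) := by
  classical
  let L : ∀ b, relFactor Q X b → G
    | true => l
    | false => FreeGroup.lift m
  have L1 : ∀ b, L b 1 = 1
    | true => hl1
    | false => map_one (FreeGroup.lift m)
  have hD := h.nonneg
  have hD' : 0 ≤ D' := (abs_nonneg _).trans (hdef 1 1)
  have hfree : ∀ x y : FreeGroup X,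
      FreeGroup.lift m x * FreeGroup.lift m y * (FreeGroup.lift m (x * y))⁻¹ = 1 := fun x y => by
    rw [map_mul, mul_inv_cancel]
  have hQ : ∀ x y : Q, π (l x * l y * (l (x * y))⁻¹) = 1 := fun x y => by simp [hl]
  have Ldef : ∀ b x y, π (L b x * L b y * (L b (x * y))⁻¹) = 1 ∧
      |φ (L b x * L b y * (L b (x * y))⁻¹)| ≤ D + D' := by
    rintro (_ | _) x y
    · have : L false x * L false y * (L false (x * y))⁻¹ = 1 := hfree x y
      rw [this]
      exact ⟨map_one π, h.abs_one.trans (by linarith)⟩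
    · exact ⟨hQ x y, (hdef x y).trans (by linarith)⟩
  let F : RelFree Q X →* CoprodI (relFactor Q X) :=
    Coprod.lift (CoprodI.of (M := relFactor Q X) (i := true))
      (CoprodI.of (M := relFactor Q X) (i := false))
  have hletter : ∀ i, ∃ b, ∃ x : relFactor Q X b, F (relLetter Q X i) = CoprodI.of x ∧
      liftLetter l m i = L b x := by
    rintro (h | ⟨x, _ | _⟩)
    · refine ⟨true, h, ?_, rfl⟩
      simp only [F, relLetter]
      exact Coprod.lift_apply_inl _ _ _
    · refine ⟨false, (FreeGroup.of x)⁻¹, ?_, ?_⟩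
      · simp only [F, relLetter]
        exact Coprod.lift_apply_inr _ _ _
      · change (m x)⁻¹ = FreeGroup.lift m (FreeGroup.of x)⁻¹
        simp
    · refine ⟨false, FreeGroup.of x, ?_, ?_⟩
      · simp only [F, relLetter]
        exact Coprod.lift_apply_inr _ _ _
      · change m x = FreeGroup.lift m (FreeGroup.of x)
        simp
  let σ : RelFree Q X → G := fun a => syllableProd L (F a • CoprodI.Word.empty)
  have key : ∀ w : List (Q ⊕ (X × Bool)),
      π (wordProd (liftLetter l m) w * (σ (relWordProd Q X w))⁻¹) = 1 ∧
      |φ (wordProd (liftLetter l m) w * (σ (relWordProd Q X w))⁻¹)| ≤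
        (D + D' + 2 * D) * w.length + D := by
    intro w
    induction w with
    | nil =>
      have : σ (relWordProd Q X []) = 1 := by simp [σ, relWordProd_nil, syllableProd]
      rw [this]
      simpa using h.abs_one
    | cons i w ih =>
      obtain ⟨b, x, hx, hxL⟩ := hletter i
      obtain ⟨y, hy⟩ := exists_syllableProd_smul L1 x (F (relWordProd Q X w) • CoprodI.Word.empty)
      obtain ⟨d1, d2⟩ := Ldef b x y
      rw [← hy, ← hxL] at d1 d2
      have e : σ (relWordProd Q X (i :: w)) =
          syllableProd L (CoprodI.of x • F (relWordProd Q X w) • CoprodI.Word.empty) := by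
        simp only [σ, relWordProd_cons, map_mul, hx, mul_smul]
      rw [← e] at d1 d2
      change π (liftLetter l m i * σ (relWordProd Q X w) * _) = 1 at d1
      change |φ (liftLetter l m i * σ (relWordProd Q X w) * _)| ≤ D + D' at d2
      have e2 : wordProd (liftLetter l m) (i :: w) * (σ (relWordProd Q X (i :: w)))⁻¹ =
          (liftLetter l m i * (wordProd (liftLetter l m) w * (σ (relWordProd Q X w))⁻¹) *
            (liftLetter l m i)⁻¹) *
          (liftLetter l m i * σ (relWordProd Q X w) * (σ (relWordProd Q X (i :: w)))⁻¹) := by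
        simp [mul_assoc]
      have k1 : π (liftLetter l m i * (wordProd (liftLetter l m) w * (σ (relWordProd Q X w))⁻¹) *
            (liftLetter l m i)⁻¹) = 1 := by
        rw [map_mul, map_mul, ih.1, mul_one, map_inv, mul_inv_cancel]
      rw [e2]
      refine ⟨by rw [map_mul, k1, d1, mul_one], ?_⟩
      have h1 := abs_le.1 (h.mul _ _ k1 d1)
      have h2 := abs_le.1 (h.conj (liftLetter l m i) _ ih.1)
      have h3 := abs_le.1 ih.2
      have h4 := abs_le.1 d2
      rw [List.length_cons]
      push_cast
      rw [abs_le]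
      constructor <;> linarith
  have h1 := (key w).2
  have : σ (relWordProd Q X w) = 1 := by simp [σ, hw, syllableProd]
  rw [this, inv_one, mul_one] at h1
  linarith

end FreeProductSection

/-! ### The two applications of the extension criterion. -/

section RelativelyHyperbolicQuotient

variable {G Γ : Type*} [Group G] [Group Γ] {π : G →* Γ} {φ : G → ℝ} {D D' : ℝ}

/-- The fibre product of `G` and `Q * F(X)` over `Γ`. -/
abbrev relPullback (π : G →* Γ) (Q : Subgroup Γ) (X : Set Γ) : Subgroup (G × RelFree Q X) :=
  (π.comp (MonoidHom.fst G (RelFree Q X))).eqLocus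
    ((relTheta Q X).comp (MonoidHom.snd G (RelFree Q X)))

/-- The projection of the fibre product onto `Q * F(X)`. -/
abbrev relPullbackSnd (π : G →* Γ) (Q : Subgroup Γ) (X : Set Γ) :
    relPullback π Q X →* RelFree Q X :=
  (MonoidHom.snd G (RelFree Q X)).comp (relPullback π Q X).subtype

theorem relTheta_surjective {Q : Subgroup Γ} {X : Set Γ} (h : IsRelGeneratingSet Q X) :
    Function.Surjective (relTheta Q X) := by
  rw [← MonoidHom.range_eq_top, eq_top_iff, ← h, Subgroup.closure_le]
  rintro g (hg | hg)
  · exact ⟨.inl ⟨g, hg⟩, by simp [relTheta]⟩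
  · exact ⟨.inr (.of ⟨g, hg⟩), by simp [relTheta]⟩

theorem abs_list_prod_le {E : Type*} [Group E] {Φ : E → ℝ} {R : ℝ}
    (hΦ : ∀ g k, |Φ (g * k) - Φ g - Φ k| ≤ R) {N : ℝ} (l : List E) (hl : ∀ g ∈ l, |Φ g| ≤ N) :
    |Φ l.prod| ≤ l.length * (N + R) + R := by
  induction l with
  | nil =>
    have := hΦ 1 1
    simp only [mul_one, sub_self, zero_sub, abs_neg] at this
    simpa using this
  | cons g l ih =>
    have h1 := abs_le.1 (ih fun k hk => hl k (by simp [hk]))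
    have h2 := abs_le.1 (hl g (by simp))
    have h3 := abs_le.1 (hΦ g l.prod)
    rw [List.prod_cons, List.length_cons]
    push_cast
    rw [abs_le]
    constructor <;> linarith

/-- Extension of quasimorphisms from the kernel of `π : G → Γ`, when `Γ` is hyperbolic relative to
`Q` and there is a section of `π` over `Q` with bounded defect. -/
theorem IsKernelQuasimorphism.exists_extension_of_isRelHyperbolic
    (h : IsKernelQuasimorphism π φ D) (hπ : Function.Surjective π) {Q : Subgroup Γ}
    (hQ : IsRelHyperbolic Q) {l : Q → G} (hl : ∀ h, π (l h) = h) (hl1 : l 1 = 1)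
    (hdef : ∀ a b, |φ (l a * l b * (l (a * b))⁻¹)| ≤ D') :
    ∃ (Φ : G → ℝ) (R : ℝ), (∀ g k, |Φ (g * k) - Φ g - Φ k| ≤ R) ∧
      ∀ k, π k = 1 → |Φ k - φ k| ≤ R := by
  obtain ⟨X, S, hS, ⟨hgen, hker⟩, C, hC⟩ := hQ
  have hS1 : ∀ r ∈ S, relTheta Q X r = 1 := fun r hr => by
    have : r ∈ (relTheta Q X).ker := hker ▸ Subgroup.subset_normalClosure hr
    exact this
  have hCw : ∀ w : List (Q ⊕ (X × Bool)), relTheta Q X (relWordProd Q X w) = 1 →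
      ∃ l : List (RelFree Q X × RelFree Q X), (l.length : ℝ) ≤ C * w.length + C ∧
        (∀ p ∈ l, p.2 ∈ S ∨ p.2⁻¹ ∈ S) ∧
        relWordProd Q X w = (l.map (fun p => p.1 * p.2 * p.1⁻¹)).prod :=
    fun w hw => hC _ _ hw (relLength_relWordProd_le Q X w)
  choose m hm using fun x : X => hπ x
  have hθ := relTheta_surjective hgen
  have hletter := map_liftLetter (X := X) hl hm
  obtain ⟨C₁, hLI⟩ := hasLinearIntegrals_of_isoperimetric (relTheta Q X) hθ hS hS1 hCw
  obtain ⟨C₂, hLI'⟩ := hasLinearIntegrals_relFree Q X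
  have hinv : ∀ i, ∃ j, π (liftLetter l m i) * π (liftLetter l m j) = 1 := fun i => by
    obtain ⟨j, hj⟩ := exists_relLetter_inv i
    exact ⟨j, by rw [hletter, hletter, ← map_mul, hj, map_one]⟩
  have hword : ∀ w, π (wordProd (liftLetter l m) w) = relTheta Q X (relWordProd Q X w) := fun w => by
    rw [map_wordProd, relWordProd, map_list_prod, wordProd, List.map_map]
    simp only [hletter]
    rfl
  let tE : Q ⊕ (X × Bool) → relPullback π Q X := fun i =>
    ⟨(liftLetter l m i, relLetter Q X i), hletter i⟩
  have tE_word : ∀ w, ((wordProd tE w : relPullback π Q X) : G × RelFree Q X) =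
      (wordProd (liftLetter l m) w, relWordProd Q X w) := fun w => by
    induction w with
    | nil => rfl
    | cons i w ih =>
      rw [wordProd_cons, Subgroup.coe_mul, ih, relWordProd_cons, wordProd_cons]
      rfl
  have hE : IsLinearOnKernel (relPullbackSnd π Q X) (fun z => φ (z : G × RelFree Q X).1) tE D
      (D + D' + 2 * D) := by
    have hker : ∀ z : relPullback π Q X, relPullbackSnd π Q X z = 1 →
        π (z : G × RelFree Q X).1 = 1 := fun z hz => by
      have h1 : π (z : G × RelFree Q X).1 = relTheta Q X (z : G × RelFree Q X).2 := z.2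
      have h2 : (z : G × RelFree Q X).2 = 1 := hz
      rw [h1, h2, map_one]
    refine ⟨⟨fun k l hk hl => h.mul _ _ (hker k hk) (hker l hl),
      fun g k hk => h.conj _ _ (hker k hk)⟩, fun i => exists_relLetter_inv i, fun a => ?_,
      fun w hw => ?_⟩
    · obtain ⟨w, hw⟩ := relWordProd_surjective Q X a
      exact ⟨w, by simp [tE_word, hw]⟩
    · have hw' : relWordProd Q X w = 1 := by simpa [tE_word] using hw
      simpa only [tE_word] using h.abs_wordProd_le_of_relWordProd_eq_one hl hl1 hdef hw' (m := m)
  -- First application, over Q * F(X). Besides extending φ, Ψ must be bounded on letters: relators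
  -- lie outside the kernel of E → Q * F(X), and both bounds are needed to compare a word with its
  -- product of relators.
  obtain ⟨Ψ, R, hΨ, hΨker, hΨt⟩ := hE.exists_extension hLI'
  have hΨ1 : |Ψ 1| ≤ R := by
    have := hΨ 1 1
    simpa only [mul_one, sub_self, zero_sub, abs_neg] using this
  have hΨinv : ∀ g, |Ψ g⁻¹ + Ψ g| ≤ 2 * R := fun g => by
    have h1 := abs_le.1 (hΨ g g⁻¹)
    rw [mul_inv_cancel] at h1
    have h2 := abs_le.1 hΨ1
    exact abs_le.2 ⟨by linarith, by linarith⟩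
  have hR : 0 ≤ R := (abs_nonneg _).trans hΨ1
  let ker : {a : RelFree Q X // relTheta Q X a = 1} → relPullback π Q X := fun a =>
    ⟨(1, a), by change π 1 = relTheta Q X a; rw [a.2, map_one]⟩
  obtain ⟨N, hN⟩ : ∃ N : ℝ, ∀ a : {a : RelFree Q X // relTheta Q X a = 1}, a.1 ∈ S →
      |Ψ (ker a)| ≤ N := by
    classical
    obtain ⟨N, hN⟩ := (hS.image fun r => if hr : relTheta Q X r = 1 then |Ψ (ker ⟨r, hr⟩)|
      else 0).bddAbove
    refine ⟨N, fun a ha => hN ⟨a.1, ha, ?_⟩⟩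
    simp [a.2]
  have hconj : ∀ p : RelFree Q X × RelFree Q X, (p.2 ∈ S ∨ p.2⁻¹ ∈ S) →
      ∃ z : relPullback π Q X, (z : G × RelFree Q X) = (1, p.1 * p.2 * p.1⁻¹) ∧
        |Ψ z| ≤ N + 6 * R := by
    rintro ⟨p, r⟩ hr
    have hr1 : relTheta Q X r = 1 := by
      rcases hr with hr | hr
      · exact hS1 r hr
      · simpa using hS1 _ hr
    have hr2 : |Ψ (ker ⟨r, hr1⟩)| ≤ N + 2 * R := by
      rcases hr with hr | hr
      · linarith [hN ⟨r, hr1⟩ hr]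
      · have h1 := abs_le.1 (hN ⟨r⁻¹, hS1 _ hr⟩ hr)
        have h2 := abs_le.1 (hΨinv (ker ⟨r⁻¹, hS1 _ hr⟩))
        have e : (ker ⟨r⁻¹, hS1 _ hr⟩)⁻¹ = ker ⟨r, hr1⟩ := Subtype.ext (by simp [ker])
        rw [e] at h2
        exact abs_le.2 ⟨by linarith, by linarith⟩
    obtain ⟨g, hg⟩ := hπ (relTheta Q X p)
    let q : relPullback π Q X := ⟨(g, p), hg⟩
    refine ⟨q * ker ⟨r, hr1⟩ * q⁻¹, by simp [q, ker], ?_⟩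
    have h1 := abs_le.1 (hΨ (q * ker ⟨r, hr1⟩) q⁻¹)
    have h2 := abs_le.1 (hΨ q (ker ⟨r, hr1⟩))
    have h3 := abs_le.1 (hΨinv q)
    have h4 := abs_le.1 hr2
    exact abs_le.2 ⟨by linarith, by linarith⟩
  have hkerbound : ∀ (L : List (RelFree Q X × RelFree Q X)), (∀ p ∈ L, p.2 ∈ S ∨ p.2⁻¹ ∈ S) →
      ∃ z : List (relPullback π Q X), z.length = L.length ∧ (∀ x ∈ z, |Ψ x| ≤ N + 6 * R) ∧
        (z.prod : G × RelFree Q X) = (1, (L.map (fun p => p.1 * p.2 * p.1⁻¹)).prod) := by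
    intro L
    induction L with
    | nil => exact fun _ => ⟨[], rfl, by simp, rfl⟩
    | cons p L ih =>
      intro hL
      obtain ⟨z, hz, hzb, hzp⟩ := ih fun q hq => hL q (by simp [hq])
      obtain ⟨y, hy, hyb⟩ := hconj p (hL p (by simp))
      refine ⟨y :: z, by simp [hz], ?_, ?_⟩
      · intro x hx
        rcases List.mem_cons.1 hx with rfl | hx
        · exact hyb
        · exact hzb x hx
      · rw [List.prod_cons, Subgroup.coe_mul, hzp, hy]
        simp
  have hlin : ∀ w, π (wordProd (liftLetter l m) w) = 1 →
      |φ (wordProd (liftLetter l m) w)| ≤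
        (|N| + 20 * R + |C| * (|N| + 7 * R)) * (w.length + 1) := by
    intro w hw
    rw [hword] at hw
    obtain ⟨L, hLlen, hLS, hLprod⟩ := hCw w hw
    obtain ⟨z, hz, hzb, hzp⟩ := hkerbound L hLS
    have h1 := abs_le.1 (abs_list_prod_le hΨ z hzb)
    have h2 := abs_le.1 (abs_list_prod_le hΨ (w.map tE) (by
      intro g hg
      obtain ⟨i, -, rfl⟩ := List.mem_map.1 hg
      exact hΨt i))
    -- The relators cancel the Q * F(X) coordinate, leaving a kernel element on which Ψ is close to
    -- φ of the word.
    have hzw : (wordProd tE w * z.prod⁻¹ : relPullback π Q X).1 =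
        (wordProd (liftLetter l m) w, 1) := by
      rw [Subgroup.coe_mul, Subgroup.coe_inv, hzp, tE_word, hLprod]
      simp
    have h3 := abs_le.1 (hΨker (wordProd tE w * z.prod⁻¹) (by
      change (wordProd tE w * z.prod⁻¹ : relPullback π Q X).1.2 = 1
      rw [hzw]))
    rw [hzw] at h3
    have h4 := abs_le.1 (hΨ (wordProd tE w) z.prod⁻¹)
    have h5 := abs_le.1 (hΨinv z.prod)
    change -(_ : ℝ) ≤ Ψ (wordProd tE w) ∧ Ψ (wordProd tE w) ≤ _ at h2
    rw [List.length_map] at h2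
    rw [hz] at h1
    have hn : (0:ℝ) ≤ w.length := Nat.cast_nonneg _
    have hN0 : N ≤ |N| := le_abs_self N
    have hL0 : (0:ℝ) ≤ L.length := Nat.cast_nonneg _
    have h6 : (L.length : ℝ) ≤ |C| * (w.length + 1) := by
      have := mul_le_mul_of_nonneg_right (le_abs_self C) (show (0:ℝ) ≤ w.length + 1 by linarith)
      linarith
    have h7 : (L.length : ℝ) * (N + 6 * R + R) ≤ |C| * (w.length + 1) * (|N| + 7 * R) :=
      (mul_le_mul_of_nonneg_left (by linarith) hL0).trans
        (mul_le_mul_of_nonneg_right h6 (by linarith [abs_nonneg N]))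
    have h8 : 0 ≤ |N| * (w.length + 1) := by positivity
    have h9 : 0 ≤ R * w.length := by positivity
    rw [abs_le]
    constructor <;> linarith
  have hG : IsLinearOnKernel π φ (liftLetter l m) D
      (|N| + 20 * R + |C| * (|N| + 7 * R)) := by
    refine ⟨h, hinv, fun γ => ?_, hlin⟩
    obtain ⟨a, rfl⟩ := hθ γ
    obtain ⟨w, rfl⟩ := relWordProd_surjective Q X a
    exact ⟨w, hword w⟩
  have hadj : (fun i => π (liftLetter l m i)) = fun i => relTheta Q X (relLetter Q X i) :=
    funext hletter
  rw [← hadj] at hLI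
  obtain ⟨Φ, R', h1, h2, -⟩ := hG.exists_extension hLI
  exact ⟨Φ, R', h1, h2⟩

end RelativelyHyperbolicQuotient

/-! ### Dehn's algorithm: hyperbolic groups are hyperbolic relative to the trivial subgroup. -/

section HyperbolicGroups

variable {Γ ι : Type*} [Group Γ]

/-- In a hyperbolic graph, a long closed word contains a subword of bounded length that can be
replaced by a shorter one. -/
theorem exists_shortening {a : ι → Γ} {d : Γ → Γ → ℕ} {δ : ℕ} (hsymm : ∀ u v, d u v = d v u)
    (hword : ∀ u w, d u (u * wordProd a w) ≤ w.length)
    (hgeod : ∀ u v, ∃ w, w.length = d u v ∧ v = u * wordProd a w)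
    (hδ : ∀ x y z w, d x y + d z w ≤ max (d x z + d y w) (d x w + d y z) + δ)
    {w : List ι} (hw : wordProd a w = 1) (hlen : 2 * (δ + 1) ≤ w.length) :
    ∃ u v v' u', w = u ++ v ++ u' ∧ v.length = 2 * (δ + 1) ∧ v'.length < v.length ∧
      wordProd a v = wordProd a v' := by
  set p : ℕ → Γ := fun i => wordProd a (w.take i) with hp
  have hsub : ∀ i j, i ≤ j → p j = p i * wordProd a ((w.take j).drop i) := fun i j hij => by
    have : w.take j = w.take i ++ (w.take j).drop i := by
      conv_lhs => rw [← List.take_append_drop i (w.take j)]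
      rw [List.take_take, min_eq_left hij]
    simp only [hp]
    conv_lhs => rw [this]
    rw [wordProd_append]
  have hdist : ∀ i j, i ≤ j → d (p i) (p j) ≤ j - i := fun i j hij => by
    rw [hsub i j hij]
    refine (hword _ _).trans ?_
    rw [List.length_drop, List.length_take]
    lia
  have hp0 : p 0 = 1 := by simp [hp]
  have hpn : p w.length = 1 := by simp [hp, hw]
  have finish : ∀ i, i + 2 * (δ + 1) ≤ w.length →
      d (p i) (p (i + 2 * (δ + 1))) < 2 * (δ + 1) → ∃ u v v' u', w = u ++ v ++ u' ∧
        v.length = 2 * (δ + 1) ∧ v'.length < v.length ∧ wordProd a v = wordProd a v' := by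
    intro i hi hlt
    obtain ⟨v', hv', hv'p⟩ := hgeod (p i) (p (i + 2 * (δ + 1)))
    have hvlen : ((w.take (i + 2 * (δ + 1))).drop i).length = 2 * (δ + 1) := by
      rw [List.length_drop, List.length_take]
      lia
    refine ⟨w.take i, (w.take (i + 2 * (δ + 1))).drop i, v', w.drop (i + 2 * (δ + 1)), ?_, hvlen,
      by lia, ?_⟩
    · conv_lhs => rw [← List.take_append_drop (i + 2 * (δ + 1)) w,
        ← List.take_append_drop i (w.take (i + 2 * (δ + 1)))]
      rw [List.take_take, min_eq_left (by lia)]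
    · rw [hsub i _ (by lia)] at hv'p
      exact mul_left_cancel hv'p
  obtain ⟨i, hi, hmax⟩ := (Finset.range (w.length + 1)).exists_max_image (fun i => d 1 (p i))
    ⟨0, by simp⟩
  simp only [Finset.mem_range] at hi hmax
  -- Let p i be farthest from 1. The four-point condition for 1, p i and the points δ + 1 steps
  -- before and after bounds the distance of the latter two by 2δ + 1, one less than the subword
  -- between them. If i is too close to an end, every point is within δ of 1, and the initial
  -- subword can be shortened.
  by_cases hmid : δ + 1 ≤ i ∧ i + (δ + 1) ≤ w.length
  · refine finish (i - (δ + 1)) (by lia) ?_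
    have e : i - (δ + 1) + 2 * (δ + 1) = i + (δ + 1) := by lia
    rw [e]
    have h1 := hδ 1 (p i) (p (i - (δ + 1))) (p (i + (δ + 1)))
    have h2 := hmax (i - (δ + 1)) (by lia)
    have h3 := hmax (i + (δ + 1)) (by lia)
    have h4 := hdist i (i + (δ + 1)) (by lia)
    have h5 := hdist (i - (δ + 1)) i (by lia)
    rw [hsymm] at h5
    rcases max_cases (d 1 (p (i - (δ + 1))) + d (p i) (p (i + (δ + 1))))
      (d 1 (p (i + (δ + 1))) + d (p i) (p (i - (δ + 1)))) with ⟨h, -⟩ | ⟨h, -⟩ <;>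
    rw [h] at h1 <;> lia
  · refine finish 0 (by lia) ?_
    have h1 := hmax (0 + 2 * (δ + 1)) (by lia)
    have h2 := hdist 0 i (by lia)
    have h3 := hdist i w.length (by lia)
    rw [hp0] at h2 ⊢
    rw [hpn, hsymm] at h3
    lia

theorem isRelHyperbolic_bot_of_isHyperbolicGroup (h : IsHyperbolicGroup Γ) :
    IsRelHyperbolic (⊥ : Subgroup Γ) := by
  obtain ⟨S, hSfin, hS, δ, hδ⟩ := h
  have : Finite S := hSfin
  set d := (SimpleGraph.mulCayley S).dist
  let a : (⊥ : Subgroup Γ) ⊕ (S × Bool) → Γ := fun i => relTheta ⊥ S (relLetter ⊥ S i)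
  have hgen : IsRelGeneratingSet (⊥ : Subgroup Γ) S := by
    rw [IsRelGeneratingSet, eq_top_iff, ← hS]
    exact Subgroup.closure_mono Set.subset_union_right
  have ha : ∀ w, wordProd a w = relTheta ⊥ S (relWordProd ⊥ S w) := fun w => by
    rw [relWordProd, map_list_prod, List.map_map]
    rfl
  have hstep : ∀ u i, u * a i = u ∨ (SimpleGraph.mulCayley S).Adj u (u * a i) := by
    intro u i
    by_cases he : u * a i = u
    · exact Or.inl he
    refine Or.inr ((SimpleGraph.mulCayley_adj' S _ _).2 ⟨Ne.symm he, ?_⟩)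
    rcases i with x | ⟨s, _ | _⟩
    · have hx := Subgroup.mem_bot.1 x.2
      exact absurd (by simp [a, relLetter, relTheta, hx]) he
    · exact ⟨s, s.2, Or.inr (by simp [a, relLetter, relTheta])⟩
    · exact ⟨s, s.2, Or.inl (by simp [a, relLetter, relTheta])⟩
  have hwalk : ∀ w u, ∃ q : (SimpleGraph.mulCayley S).Walk u (u * wordProd a w),
      q.length ≤ w.length := by
    intro w
    induction w with
    | nil => exact fun u => ⟨SimpleGraph.Walk.nil.copy rfl (by simp), (SimpleGraph.Walk.length_copy _ _ _).le⟩
    | cons i w ih =>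
      intro u
      obtain ⟨q, hq⟩ := ih (u * a i)
      have e : u * a i * wordProd a w = u * wordProd a (i :: w) := by simp [mul_assoc]
      rcases hstep u i with h | h
      · exact ⟨q.copy h e, by simp; lia⟩
      · exact ⟨(SimpleGraph.Walk.cons h q).copy rfl e, by simpa using hq⟩
  have hreach : ∀ u v, (SimpleGraph.mulCayley S).Reachable u v := by
    intro u v
    obtain ⟨b, hb⟩ := relTheta_surjective hgen (u⁻¹ * v)
    obtain ⟨w, rfl⟩ := relWordProd_surjective _ _ b
    obtain ⟨q, -⟩ := hwalk w u
    rw [ha, hb, mul_inv_cancel_left] at q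
    exact q.reachable
  have hwalk' : ∀ u v (q : (SimpleGraph.mulCayley S).Walk u v),
      ∃ w, w.length = q.length ∧ v = u * wordProd a w := by
    intro u v q
    induction q with
    | nil => exact ⟨[], rfl, by simp⟩
    | @cons u x v hux q ih =>
      obtain ⟨w, hw, rfl⟩ := ih
      have : ∃ i, x = u * a i := by
        obtain ⟨-, s, hs, h | h⟩ := (SimpleGraph.mulCayley_adj' S _ _).1 hux
        · exact ⟨Sum.inr (⟨s, hs⟩, true), by simp [a, relLetter, relTheta, h]⟩
        · exact ⟨Sum.inr (⟨s, hs⟩, false), by simp [a, relLetter, relTheta, h]⟩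
      obtain ⟨i, rfl⟩ := this
      exact ⟨i :: w, by simp [hw], by simp [mul_assoc]⟩
  let N := 2 * (δ + 1)
  -- The relators v v'⁻¹ are the replacements of Dehn's algorithm. They are finitely many because
  -- the alphabet, with the single letter from ⊥, is finite. Each replacement shortens the word, so
  -- at most n + 1 conjugates are used.
  let R : Set (RelFree (⊥ : Subgroup Γ) S) := {x | (∃ v v', v.length ≤ N ∧ v'.length ≤ N ∧
    x = relWordProd ⊥ S v * (relWordProd ⊥ S v')⁻¹) ∧ relTheta ⊥ S x = 1}
  have hRfin : R.Finite := by
    have hf := List.finite_length_le ((⊥ : Subgroup Γ) ⊕ (S × Bool)) N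
    refine (hf.image2 (fun v v' => relWordProd ⊥ S v * (relWordProd ⊥ S v')⁻¹) hf).subset ?_
    rintro x ⟨⟨v, v', hv, hv', rfl⟩, -⟩
    exact ⟨v, hv, v', hv', rfl⟩
  have hiso : ∀ (n : ℕ) (w : List ((⊥ : Subgroup Γ) ⊕ (S × Bool))), w.length ≤ n →
      wordProd a w = 1 →
      ∃ l : List (RelFree (⊥ : Subgroup Γ) S × RelFree (⊥ : Subgroup Γ) S), l.length ≤ n + 1 ∧
        (∀ p ∈ l, p.2 ∈ R ∨ p.2⁻¹ ∈ R) ∧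
        relWordProd ⊥ S w = (l.map (fun p => p.1 * p.2 * p.1⁻¹)).prod := by
    intro n
    induction n with
    | zero =>
      intro w hw _
      obtain rfl := List.length_eq_zero_iff.1 (Nat.le_zero.1 hw)
      exact ⟨[], by simp, by simp, by simp [relWordProd_nil]⟩
    | succ n ih =>
      intro w hwn hw
      rcases Nat.lt_or_ge w.length N with hlt | hge
      · refine ⟨[(1, relWordProd ⊥ S w)], by simp, ?_, by simp⟩
        simp only [List.mem_singleton, forall_eq]
        exact Or.inl ⟨⟨w, [], hlt.le, by simp, by simp [relWordProd_nil]⟩, by rw [← ha, hw]⟩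
      · obtain ⟨u, v, v', u', rfl, hv, hv', hvv⟩ := exists_shortening (d := d) (δ := δ) (a := a)
          (fun u v => SimpleGraph.dist_comm)
          (fun u w => by
            obtain ⟨q, hq⟩ := hwalk w u
            exact (SimpleGraph.dist_le q).trans hq)
          (fun u v => by
            obtain ⟨q, hq⟩ := (hreach u v).exists_walk_length_eq_dist
            obtain ⟨w, hw, hv⟩ := hwalk' u v q
            exact ⟨w, hw.trans hq, hv⟩)
          hδ hw hge
        simp only [List.length_append] at hwn
        obtain ⟨l, hl, hlR, hprod⟩ := ih (u ++ v' ++ u') (by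
          simp only [List.length_append]
          lia) (by
          simp only [wordProd_append] at hw ⊢
          rwa [← hvv])
        refine ⟨(relWordProd ⊥ S u, relWordProd ⊥ S v * (relWordProd ⊥ S v')⁻¹) :: l, by
          simp only [List.length_cons]
          lia, ?_, ?_⟩
        · intro p hp
          rcases List.mem_cons.1 hp with rfl | hp
          · refine Or.inl ⟨⟨v, v', hv.le, by lia, rfl⟩, ?_⟩
            rw [map_mul, map_inv, ← ha, ← ha, hvv, mul_inv_cancel]
          · exact hlR p hp
        · rw [List.map_cons, List.prod_cons, ← hprod]
          simp only [relWordProd_append]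
          group
  have hiso' : ∀ (n : ℕ) (x : RelFree (⊥ : Subgroup Γ) S), x ∈ (relTheta ⊥ S).ker →
      relLength ⊥ S x ≤ n →
      ∃ l : List (RelFree (⊥ : Subgroup Γ) S × RelFree (⊥ : Subgroup Γ) S), l.length ≤ n + 1 ∧
        (∀ p ∈ l, p.2 ∈ R ∨ p.2⁻¹ ∈ R) ∧
        x = (l.map (fun p => p.1 * p.2 * p.1⁻¹)).prod := by
    intro n x hx hn
    obtain ⟨w₀, hw₀⟩ := relWordProd_surjective ⊥ S x
    obtain ⟨w, hw, rfl⟩ := Nat.sInf_mem (s := {n | ∃ w : List ((⊥ : Subgroup Γ) ⊕ (S × Bool)),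
      w.length = n ∧ relWordProd ⊥ S w = x}) ⟨_, w₀, rfl, hw₀⟩
    exact hiso n w (hw.le.trans hn) ((ha w).trans hx)
  refine ⟨S, R, hRfin, ⟨hgen, le_antisymm ?_ ?_⟩, 1, ?_⟩
  · exact Subgroup.normalClosure_le_normal fun x hx => hx.2
  · intro x hx
    obtain ⟨l, -, hlR, rfl⟩ := hiso' _ x hx le_rfl
    refine Subgroup.list_prod_mem _ fun y hy => ?_
    obtain ⟨p, hp, rfl⟩ := List.mem_map.1 hy
    refine Subgroup.normalClosure_normal.conj_mem _ ?_ _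
    rcases hlR p hp with h | h
    · exact Subgroup.subset_normalClosure h
    · exact inv_mem_iff.1 (Subgroup.subset_normalClosure h)
  · intro n x hx hn
    obtain ⟨l, hl, hlR, hprod⟩ := hiso' n x hx hn
    refine ⟨l, ?_, hlR, hprod⟩
    have : (l.length : ℝ) ≤ n + 1 := by exact_mod_cast hl
    linarith

end HyperbolicGroups

/-! ### From kernels to subgroups, and from approximate to exact extensions. -/

section ExtensionToTheGroup

variable {G : Type*} [Group G] {K : Subgroup G} {φ : K → ℝ}

open Classical in
/-- Extension of a function on a subgroup by zero. -/
noncomputable def extendZero (φ : K → ℝ) (g : G) : ℝ := if h : g ∈ K then φ ⟨g, h⟩ else 0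

theorem extendZero_coe (k : K) : extendZero φ (k : G) = φ k := by simp [extendZero]

theorem isKernelQuasimorphism_extendZero [K.Normal] (hφ : IsQuasimorphism φ)
    (hinv : IsQuasiInvariant K φ) :
    ∃ D, IsKernelQuasimorphism (QuotientGroup.mk' K) (extendZero φ) D := by
  obtain ⟨D₁, h₁⟩ := hφ
  obtain ⟨D₂, h₂⟩ := hinv
  have mem : ∀ k, QuotientGroup.mk' K k = 1 → k ∈ K := fun k hk =>
    (QuotientGroup.eq_one_iff k).1 hk
  refine ⟨max D₁ D₂, fun k l hk hl => ?_, fun g k hk => ?_⟩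
  · have h := h₁ ⟨k, mem k hk⟩ ⟨l, mem l hl⟩
    have e := extendZero_coe (φ := φ) (⟨k, mem k hk⟩ * ⟨l, mem l hl⟩)
    rw [Subgroup.coe_mul] at e
    dsimp only at e
    rw [e, show extendZero φ k = _ from extendZero_coe (φ := φ) ⟨k, mem k hk⟩,
      show extendZero φ l = _ from extendZero_coe (φ := φ) ⟨l, mem l hl⟩, abs_sub_comm, ← sub_add,
      ← abs_neg]
    refine le_trans (le_of_eq ?_) (h.trans (le_max_left _ _))
    rw [abs_neg]
    congr 1
    ring
  · have hc : g * k * g⁻¹ ∈ K := ‹K.Normal›.conj_mem k (mem k hk) g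
    rw [show extendZero φ k = _ from extendZero_coe (φ := φ) ⟨k, mem k hk⟩,
      show extendZero φ (g * k * g⁻¹) = _ from extendZero_coe (φ := φ) ⟨_, hc⟩, abs_sub_comm]
    exact (h₂ _ _ (isConj_iff.2 ⟨g, rfl⟩)).trans (le_max_right _ _)

/-- An approximate extension can be corrected to an exact antisymmetric one. -/
theorem extendsAntisymmetrically_of_approx (hanti : IsAntisymmetricFun φ) {Φ : G → ℝ} {R : ℝ}
    (hΦ : ∀ g k, |Φ (g * k) - Φ g - Φ k| ≤ R) (hK : ∀ k : K, |Φ k - φ k| ≤ R) :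
    ExtendsAntisymmetrically K φ := by
  classical
  -- Prescribing φ on K and antisymmetrizing elsewhere moves Φ by a bounded amount, so the defect
  -- stays finite.
  let Ψ : G → ℝ := fun g => if h : g ∈ K then φ ⟨g, h⟩ else (Φ g - Φ g⁻¹) / 2
  have hclose : ∀ g, |Ψ g - Φ g| ≤ R := by
    intro g
    by_cases h : g ∈ K
    · simp only [Ψ, h, dif_pos]
      rw [abs_sub_comm]
      exact hK ⟨g, h⟩
    · simp only [Ψ, h, dif_neg, not_false_eq_true]
      have h1 := abs_le.1 (hΦ g g⁻¹)
      have h2 := abs_le.1 (hΦ 1 1)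
      rw [mul_inv_cancel] at h1
      rw [mul_one] at h2
      exact abs_le.2 ⟨by linarith, by linarith⟩
  refine ⟨Ψ, ⟨4 * R, fun g k => ?_⟩, fun g => ?_, fun k => by simp [Ψ]⟩
  · have h1 := abs_le.1 (hclose g)
    have h2 := abs_le.1 (hclose k)
    have h3 := abs_le.1 (hclose (g * k))
    have h4 := abs_le.1 (hΦ g k)
    exact abs_le.2 ⟨by linarith, by linarith⟩
  · by_cases h : g ∈ K
    · simp only [Ψ, h, inv_mem h, dif_pos]
      exact hanti ⟨g, h⟩
    · simp only [Ψ, h, inv_mem_iff, dif_neg, not_false_eq_true, inv_inv]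
      ring

theorem extendsAntisymmetrically_of_section [K.Normal] (hφ : IsQuasimorphism φ)
    (hanti : IsAntisymmetricFun φ) (hinv : IsQuasiInvariant K φ) {Q : Subgroup (G ⧸ K)}
    (hQ : IsRelHyperbolic Q) {l : Q → G} (hl : ∀ h, (l h : G ⧸ K) = h) (hl1 : l 1 = 1) {D' : ℝ}
    (hdef : ∀ a b, |extendZero φ (l a * l b * (l (a * b))⁻¹)| ≤ D') :
    ExtendsAntisymmetrically K φ := by
  obtain ⟨D, hD⟩ := isKernelQuasimorphism_extendZero hφ hinv
  obtain ⟨Φ, R, h1, h2⟩ := hD.exists_extension_of_isRelHyperbolic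
    (QuotientGroup.mk'_surjective K) hQ hl hl1 hdef
  refine extendsAntisymmetrically_of_approx hanti h1 fun k => ?_
  rw [← extendZero_coe (φ := φ)]
  exact h2 k ((QuotientGroup.eq_one_iff _).2 k.2)

/-- A controlled transversal has bounded defect. -/
theorem IsControlled.exists_defect_le {H : Subgroup G} {L : Set H}
    (hc : IsControlled (K.subgroupOf H) L (restrictInter K H φ)) :
    ∃ D', ∀ a b c : L, ((a : H) : G) * (b : H) * ((c : H) : G)⁻¹ ∈ K →
      |extendZero φ (((a : H) : G) * (b : H) * ((c : H) : G)⁻¹)⁻¹| ≤ D' := by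
  obtain ⟨f, hf⟩ := hc
  -- The defect κ = abc⁻¹ gives the four-letter word a·b·c⁻¹·κ⁻¹ in ker θ, whose image under η is
  -- κ⁻¹.
  refine ⟨f 4, fun a b c hk => ?_⟩
  let κ : K.subgroupOf H := ⟨(a : H) * b * (c : H)⁻¹, Subgroup.mem_subgroupOf.2 hk⟩
  have h := hf 4 (relWordProd _ L [.inr (a, true), .inr (b, true), .inr (c, false), .inl κ⁻¹]) ?_
    (relLength_relWordProd_le _ _ _)
  · have e : relEta (K.subgroupOf H) L
        (relWordProd _ L [.inr (a, true), .inr (b, true), .inr (c, false), .inl κ⁻¹]) = κ⁻¹ := by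
      simp [relWordProd, relLetter, relEta]
    rw [e] at h
    have e2 : extendZero φ (((a : H) : G) * (b : H) * ((c : H) : G)⁻¹)⁻¹ =
        restrictInter K H φ κ⁻¹ :=
      extendZero_coe (φ := φ) ⟨_, inv_mem hk⟩
    rwa [e2]
  · rw [MonoidHom.mem_ker]
    simp [relWordProd, relLetter, relTheta, κ, mul_assoc]

end ExtensionToTheGroup

/-- A transversal `L` of `K ∩ H` in `H` is expressed by `Subgroup.IsComplement`: every element of
`H` is uniquely `l * k` with `l ∈ L` and `k ∈ K ∩ H`. The image of `H` in `G ⧸ K` is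
`H / (K ∩ H)`. -/
theorem corollary5p6 {G : Type*} [Group G] (K : Subgroup G) [K.Normal] (φ : K → ℝ)
    (hφ : IsQuasimorphism φ) (hanti : IsAntisymmetricFun φ) (hinv : IsQuasiInvariant K φ) :
    (∀ H : Subgroup G, IsRelHyperbolic (H.map (QuotientGroup.mk' K)) →
      (∃ L : Set H, Subgroup.IsComplement L ((K.subgroupOf H : Subgroup H) : Set H) ∧
        IsControlled (K.subgroupOf H) L (restrictInter K H φ)) →
      ExtendsAntisymmetrically K φ) ∧
    (IsHyperbolicGroup (G ⧸ K) → ExtendsAntisymmetrically K φ) := by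
  constructor
  · rintro H hH ⟨L, hL, hc⟩
    obtain ⟨D, hD⟩ := isKernelQuasimorphism_extendZero hφ hinv
    obtain ⟨D', hD'⟩ := hc.exists_defect_le
    have hex : ∀ q : H.map (QuotientGroup.mk' K), ∃ l : L, (((l : H) : G) : G ⧸ K) = q := by
      rintro ⟨_, h, hh, rfl⟩
      obtain ⟨⟨l, k⟩, hlk⟩ := hL.2 ⟨h, hh⟩
      refine ⟨l, ?_⟩
      have hk : ((k : H) : G) ∈ K := Subgroup.mem_subgroupOf.1 k.2
      have e : ((l : H) : G) * (k : H) = h := congrArg Subtype.val hlk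
      change (((l : H) : G) : G ⧸ K) = (h : G ⧸ K)
      rw [← e]
      exact (QuotientGroup.mk_mul_of_mem _ hk).symm
    choose l hl using hex
    have hl1 : (((l 1 : H) : G) : G ⧸ K) = 1 := hl 1
    refine extendsAntisymmetrically_of_section hφ hanti hinv hH
      (l := fun q => ((l q : H) : G) * ((l 1 : H) : G)⁻¹)
      (D' := D' + 2 * D + (D + |extendZero φ ((l 1 : H) : G)⁻¹|) + D)
      (fun q => by rw [QuotientGroup.mk_mul, QuotientGroup.mk_inv, hl, hl1, inv_one, mul_one])
      (mul_inv_cancel _) (fun a b => ?_)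
    -- The representative of the trivial coset need not be 1, so the section is normalized by (l
    -- 1)⁻¹. This multiplies each defect by a conjugate of the fixed element (l 1)⁻¹ of K, a bounded
    -- change by quasi-invariance.
    have e : ((l a : H) : G) * ((l 1 : H) : G)⁻¹ * (((l b : H) : G) * ((l 1 : H) : G)⁻¹) *
        (((l (a * b) : H) : G) * ((l 1 : H) : G)⁻¹)⁻¹ =
        ((l a : H) : G) * ((l 1 : H) : G)⁻¹ * ((l a : H) : G)⁻¹ *
          (((l a : H) : G) * (l b : H) * ((l (a * b) : H) : G)⁻¹) := by group
    have k1 : QuotientGroup.mk' K (((l 1 : H) : G)⁻¹) = 1 := by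
      rw [map_inv, QuotientGroup.mk'_apply, hl1, inv_one]
    have k2 : QuotientGroup.mk' K (((l a : H) : G) * (l b : H) * ((l (a * b) : H) : G)⁻¹) = 1 := by
      simp only [map_mul, map_inv, QuotientGroup.mk'_apply, hl]
      simp
    have k3 : QuotientGroup.mk' K
        (((l a : H) : G) * ((l 1 : H) : G)⁻¹ * ((l a : H) : G)⁻¹) = 1 := by
      rw [map_mul, map_mul, k1, mul_one, map_inv, mul_inv_cancel]
    rw [e]
    have h1 := abs_le.1 (hD.mul _ _ k3 k2)
    have h2 := abs_le.1 (hD.conj ((l a : H) : G) _ k1)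
    have h3 := abs_le.1 (hD.abs_inv k2)
    have h4 := abs_le.1 (hD' (l a) (l b) (l (a * b)) ((QuotientGroup.eq_one_iff _).1 k2))
    have h5 := abs_le.1 (le_refl |extendZero φ ((l 1 : H) : G)⁻¹|)
    exact abs_le.2 ⟨by linarith, by linarith⟩
  · intro h
    refine extendsAntisymmetrically_of_section hφ hanti hinv
      (isRelHyperbolic_bot_of_isHyperbolicGroup h) (l := fun _ => 1) (D' := |extendZero φ 1|)
      (fun q => ?_) rfl (fun a b => by simp)
    rw [Subgroup.mem_bot.1 q.2]
    rfl
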